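/- Let $\mathbb F_q$ be a finite field, let $a_1,b_1,a_2,b_2,a_3,b_3\in\mathbb F_q$ be non-zero, and let $(N_1,N_2,N_3)$ be random variables in $\mathbb F_q$ with an arbitrary joint law (for example, independent). Consider the memoryless two-way wiretap channel with $Y_1=a_1X_1+b_1X_2+N_1$, $Y_2=a_2X_1+b_2X_2+N_2$, $Z=a_3X_1+b_3X_2+N_3$, where $(N_1,N_2,N_3)$ is independent of $(X_1,X_2)$ and is drawn afresh, with the same law, at each channel use; User $i$ sends $X_i$ and receives $Y_i$, and an eavesdropper receives $Z$. A code of length $n$ consists of message sets of sizes $L_1,L_2\ge 1$, one encoder and one decoder for each user; its rates are $R_{i,n}=\frac1n\log L_i$ (natural logarithm), and the messages $M_1,M_2$ are independent and uniform. Both encoders are of the same type: a non-adaptive encoder ($c=N$) chooses the whole block $X_i^n$ at random from a distribution that depends on $M_i$ only; an adaptive encoder ($c=A$) chooses $X_{i,t}$, for $t=1,\dots,n$, at random from a distribution that depends on $M_i$, on the outputs $Y_i^{t-1}$ already received and (as local randomness may be kept) on the user's own previous inputs $X_i^{t-1}$. The randomizations of the two users are independent of each other and of the noise. Both decoders are of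 the same type: User $i$ estimates the other user's message by a function of $(M_i,X_i^n,Y_i^n)$ ($d=1$) or of $(X_i^n,Y_i^n)$ ($d=2$). Let $P_e^n$ be the probability that at least one of the two estimates is wrong. A pair $(R_1,R_2)\in\mathbb R^2$ belongs to the region $\mathcal C_{I,b,c,d}$ if there are codes of type $c,d$ of every length $n\geq 1$, and sequences $\epsilon_n\to0$, $\tau_n\to0$, such that $R_{i,n}\to R_i$ for $i=1,2$, $P_e^n\le\epsilon_n$, and, for both $i=1,2$, $I(M_i;Z^n)\le\tau_n$ if $b=S$ (strong secrecy), respectively $I(M_i;Z^n)\le n\tau_n$ if $b=W$ (weak secrecy). If $\max\{H(N_1),H(N_2)\}\le H(N_3)$, where $H$ is the Shannon entropy with natural logarithm, then for all $b\in\{S,W\}$, $c\in\{N,A\}$, $d\in\{1,2\}$, $$\mathcal C_{I,b,c,d}=\mathcal A_O:=\{(R_1,R_2): R_1\ge 0,\ R_2\ge 0,\ R_1\le\log q-H(N_2),\ R_2\le\log q-H(N_1)\}.$$ In particular adaptation does not enlarge the individual secrecy capacity region in this case. -/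

import Mathlib

open Filter Topology

namespace TwoWayWiretap

noncomputable section

/-! Probability distributions on a finite set `α` are elements of `stdSimplex ℝ α`, and
`stdSimplex.map f P` is the law of `f A` when `A` has law `P`. All logarithms are natural. -/

/-- Shannon entropy `-∑ P(a) log P(a)` of a distribution on a finite set. -/
def entropy {α : Type*} [Fintype α] (P : stdSimplex ℝ α) : ℝ :=
  ∑ a, Real.negMulLog (P a)

/-- Mutual information `I(A;B) = H(A) + H(B) - H(A,B)` of a pair `(A, B)` with joint law `P`. -/
def mutualInfo {α β : Type*} [Fintype α] [Fintype β] (P : stdSimplex ℝ (α × β)) : ℝ :=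
  entropy (stdSimplex.map Prod.fst P) + entropy (stdSimplex.map Prod.snd P) - entropy P

/-- A two-way wiretap channel `P_{Y₁ Y₂ Z | X₁ X₂}` with finite alphabets. -/
abbrev Channel (X₁ X₂ Y₁ Y₂ Z : Type*) [Fintype Y₁] [Fintype Y₂] [Fintype Z] :=
  X₁ → X₂ → stdSimplex ℝ (Y₁ × Y₂ × Z)

/-- The two types of encoders. -/
inductive EncoderType
  | adaptive
  | nonadaptive

/-- The two types of decoders. -/
inductive DecoderType
  | first
  | second

/-- The two secrecy criteria. -/
inductive SecrecyType
  | strong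
  | weak

/-- A stochastic encoder of block length `n` for `L` messages, of a user with input alphabet `X`
and output alphabet `Y`.
* A nonadaptive encoder chooses the whole input block at random, given the message.
* An adaptive encoder chooses the `t`-th input at random, given the message and the user's own
  past outputs; the local randomness may be kept from one time to the next, so that the
  distribution of the `t`-th input may also depend on the user's own past inputs. -/
inductive Encoder (X Y : Type*) [Fintype X] (n L : ℕ) : EncoderType → Type _
  | adaptive (φ : (t : Fin n) → Fin L → (Fin t → X) → (Fin t → Y) → stdSimplex ℝ X) :
      Encoder X Y n L EncoderType.adaptive
  | nonadaptive (φ : Fin L → stdSimplex ℝ (Fin n → X)) :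
      Encoder X Y n L EncoderType.nonadaptive

/-- The restriction of a block to the times before `t`. -/
def past {A : Type*} {n : ℕ} (a : Fin n → A) (t : Fin n) : Fin t → A :=
  fun s => a (Fin.castLE t.isLt.le s)

/-- The probability that the encoder produces the input block `x`, for the message `m` and
when the user receives the outputs `y`. -/
def Encoder.prob {X Y : Type*} [Fintype X] {n L : ℕ} {c : EncoderType}
    (e : Encoder X Y n L c) (m : Fin L) (x : Fin n → X) (y : Fin n → Y) : ℝ :=
  match e with
  | .adaptive φ => ∏ t, φ t m (past x t) (past y t) (x t)
  | .nonadaptive φ => φ m x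

/-- A decoder of a user with `L` messages of its own and `L'` messages to decode: of the first
type if it uses the own message, the own input block and the own output block; of the second
type if it uses only the two blocks. -/
inductive Decoder (X Y : Type*) (n L L' : ℕ) : DecoderType → Type _
  | first (ψ : Fin L → (Fin n → X) → (Fin n → Y) → Fin L') :
      Decoder X Y n L L' DecoderType.first
  | second (ψ : (Fin n → X) → (Fin n → Y) → Fin L') :
      Decoder X Y n L L' DecoderType.second

/-- The decoded message. -/
def Decoder.decode {X Y : Type*} {n L L' : ℕ} {d : DecoderType}
    (D : Decoder X Y n L L' d) (m : Fin L) (x : Fin n → X) (y : Fin n → Y) : Fin L' :=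
  match D with
  | .first ψ => ψ m x y
  | .second ψ => ψ x y

/-- A code of block length `n` with `L₁` and `L₂` messages. -/
structure Code (X₁ X₂ Y₁ Y₂ : Type*) [Fintype X₁] [Fintype X₂]
    (c : EncoderType) (d : DecoderType) (n : ℕ) where
  L₁ : ℕ
  L₂ : ℕ
  L₁_pos : 0 < L₁
  L₂_pos : 0 < L₂
  enc₁ : Encoder X₁ Y₁ n L₁ c
  enc₂ : Encoder X₂ Y₂ n L₂ c
  dec₁ : Decoder X₁ Y₁ n L₁ L₂ d
  dec₂ : Decoder X₂ Y₂ n L₂ L₁ d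

/-- A trace of `n` channel uses: at each time `t` the symbols `(x₁, x₂, y₁, y₂, z)`. -/
abbrev Trace (X₁ X₂ Y₁ Y₂ Z : Type*) (n : ℕ) := Fin n → X₁ × X₂ × Y₁ × Y₂ × Z

namespace Trace

variable {X₁ X₂ Y₁ Y₂ Z : Type*} {n : ℕ}

def x₁ (a : Trace X₁ X₂ Y₁ Y₂ Z n) : Fin n → X₁ := fun t => (a t).1
def x₂ (a : Trace X₁ X₂ Y₁ Y₂ Z n) : Fin n → X₂ := fun t => (a t).2.1
def y₁ (a : Trace X₁ X₂ Y₁ Y₂ Z n) : Fin n → Y₁ := fun t => (a t).2.2.1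
def y₂ (a : Trace X₁ X₂ Y₁ Y₂ Z n) : Fin n → Y₂ := fun t => (a t).2.2.2.1
def z (a : Trace X₁ X₂ Y₁ Y₂ Z n) : Fin n → Z := fun t => (a t).2.2.2.2

end Trace

/-- A process whose next symbol is drawn from `K (past)` has total mass one. -/
theorem sum_prod_kernel {A : Type*} [Fintype A] (n : ℕ)
    (K : (t : ℕ) → (Fin t → A) → A → ℝ) (hK : ∀ t p, ∑ a, K t p a = 1) :
    ∑ a : Fin n → A, ∏ t : Fin n, K t (past a t) (a t) = 1 := by
  induction n with
  | zero => simp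
  | succ n ih =>
    rw [← (Fin.snocEquiv (fun _ : Fin (n + 1) => A)).sum_comp, Fintype.sum_prod_type_right]
    rw [← ih]
    refine Finset.sum_congr rfl fun p _ => ?_
    have h1 : ∀ a : A, ∏ t : Fin (n + 1), K t (past ((Fin.snocEquiv fun _ : Fin (n + 1) => A) (a, p)) t)
        ((Fin.snocEquiv fun _ : Fin (n + 1) => A) (a, p) t)
        = (∏ t : Fin n, K t (past p t) (p t)) * K n p a := by
      intro a
      rw [Fin.prod_univ_castSucc]
      have h2 : past ((Fin.snocEquiv fun _ : Fin (n + 1) => A) (a, p)) (Fin.last n) = p := by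
        funext s
        change Fin.snoc (α := fun _ => A) p a (Fin.castSucc s) = p s
        exact Fin.snoc_castSucc (α := fun _ => A) a p s
      have h3 : ∀ t : Fin n,
          past ((Fin.snocEquiv fun _ : Fin (n + 1) => A) (a, p)) t.castSucc = past p t := by
        intro t
        funext s
        change Fin.snoc (α := fun _ => A) p a (Fin.castSucc (Fin.castLE t.isLt.le s)) = _
        exact Fin.snoc_castSucc (α := fun _ => A) a p _
      have h4 : ∀ t : Fin n,
          (Fin.snocEquiv fun _ : Fin (n + 1) => A) (a, p) t.castSucc = p t := by
        intro t
        exact Fin.snoc_castSucc (α := fun _ => A) a p t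
      have h5 : (Fin.snocEquiv fun _ : Fin (n + 1) => A) (a, p) (Fin.last n) = a :=
        Fin.snoc_last (α := fun _ => A) a p
      rw [h5]
      congr 1
      · exact Finset.prod_congr rfl fun t _ => by rw [h3, h4]; rfl
      · exact congrArg (fun q => K n q a) h2
    simp_rw [h1]
    rw [← Finset.mul_sum, hK, mul_one]

section Law

variable {X₁ X₂ Y₁ Y₂ Z : Type*} [Fintype X₁] [Fintype X₂] [Fintype Y₁] [Fintype Y₂] [Fintype Z]

/-- The probability of a trace, given the messages `m₁` and `m₂`, when the two encoders are used
over the memoryless channel `W`. -/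
def traceProb (W : Channel X₁ X₂ Y₁ Y₂ Z) {n L₁ L₂ : ℕ} {c : EncoderType}
    (e₁ : Encoder X₁ Y₁ n L₁ c) (e₂ : Encoder X₂ Y₂ n L₂ c) (m₁ : Fin L₁) (m₂ : Fin L₂)
    (a : Trace X₁ X₂ Y₁ Y₂ Z n) : ℝ :=
  e₁.prob m₁ a.x₁ a.y₁ * e₂.prob m₂ a.x₂ a.y₂ *
    ∏ t, W (a.x₁ t) (a.x₂ t) (a.y₁ t, a.y₂ t, a.z t)

theorem Encoder.prob_nonneg {X Y : Type*} [Fintype X] {n L : ℕ} {c : EncoderType}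
    (e : Encoder X Y n L c) (m : Fin L) (x : Fin n → X) (y : Fin n → Y) : 0 ≤ e.prob m x y := by
  cases e with
  | adaptive φ => exact Finset.prod_nonneg fun t _ => stdSimplex.zero_le _ _
  | nonadaptive φ => exact stdSimplex.zero_le _ _

theorem traceProb_mem (W : Channel X₁ X₂ Y₁ Y₂ Z) {n L₁ L₂ : ℕ} {c : EncoderType}
    (e₁ : Encoder X₁ Y₁ n L₁ c) (e₂ : Encoder X₂ Y₂ n L₂ c) (m₁ : Fin L₁) (m₂ : Fin L₂) :
    traceProb W e₁ e₂ m₁ m₂ ∈ stdSimplex ℝ (Trace X₁ X₂ Y₁ Y₂ Z n) := by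
  refine ⟨fun a => mul_nonneg (mul_nonneg (e₁.prob_nonneg _ _ _) (e₂.prob_nonneg _ _ _))
    (Finset.prod_nonneg fun t _ => stdSimplex.zero_le _ _), ?_⟩
  cases e₁ with
  | adaptive φ₁ =>
    cases e₂ with
    | adaptive φ₂ =>
      by_cases hn : n = 0
      · subst hn
        simp [traceProb, Encoder.prob]
      have h0 : 0 < n := Nat.pos_of_ne_zero hn
      let K : (t : ℕ) → (Fin t → X₁ × X₂ × Y₁ × Y₂ × Z) → X₁ × X₂ × Y₁ × Y₂ × Z → ℝ :=
        fun t p b => if ht : t < n then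
          φ₁ ⟨t, ht⟩ m₁ (fun s => (p s).1) (fun s => (p s).2.2.1) b.1 *
            φ₂ ⟨t, ht⟩ m₂ (fun s => (p s).2.1) (fun s => (p s).2.2.2.1) b.2.1 *
            W b.1 b.2.1 b.2.2
          else φ₁ ⟨0, h0⟩ m₁ Fin.elim0 Fin.elim0 b.1 * φ₂ ⟨0, h0⟩ m₂ Fin.elim0 Fin.elim0 b.2.1 *
            W b.1 b.2.1 b.2.2
      have key : ∀ (P : stdSimplex ℝ X₁) (Q : stdSimplex ℝ X₂),
          ∑ b : X₁ × X₂ × Y₁ × Y₂ × Z, P b.1 * Q b.2.1 * W b.1 b.2.1 b.2.2 = 1 := by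
        intro P Q
        rw [Fintype.sum_prod_type]
        simp_rw [Fintype.sum_prod_type (f := fun b : X₂ × Y₁ × Y₂ × Z => _), ← Finset.mul_sum,
          stdSimplex.sum_eq_one, mul_one, ← Finset.mul_sum, stdSimplex.sum_eq_one, mul_one,
          stdSimplex.sum_eq_one]
      have hK : ∀ t p, ∑ a, K t p a = 1 := by
        intro t p
        by_cases ht : t < n
        · simp only [K, ht, dif_pos]
          exact key _ _
        · simp only [K, ht, dif_neg, not_false_eq_true]
          exact key _ _
      rw [← sum_prod_kernel n K hK]
      refine Finset.sum_congr rfl fun a _ => ?_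
      simp only [traceProb, Encoder.prob, ← Finset.prod_mul_distrib]
      refine Finset.prod_congr rfl fun t _ => ?_
      simp only [K, t.isLt, dif_pos]
      rfl
  | nonadaptive φ₁ =>
    cases e₂ with
    | nonadaptive φ₂ =>
      have hW : ∀ (x : Fin n → X₁) (y : Fin n → X₂),
          ∑ w : Fin n → Y₁ × Y₂ × Z, ∏ t, W (x t) (y t) (w t) = 1 := by
        intro x y
        rw [← Fintype.prod_sum fun t b => W (x t) (y t) b]
        simp
      rw [← (Equiv.arrowProdEquivProdArrow (Fin n) (fun _ => X₁)
        (fun _ => X₂ × Y₁ × Y₂ × Z)).symm.sum_comp, Fintype.sum_prod_type]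
      have h : ∀ x : Fin n → X₁, ∑ r : Fin n → X₂ × Y₁ × Y₂ × Z,
          traceProb W (.nonadaptive φ₁) (.nonadaptive φ₂) m₁ m₂
            ((Equiv.arrowProdEquivProdArrow (Fin n) (fun _ => X₁)
              (fun _ => X₂ × Y₁ × Y₂ × Z)).symm (x, r)) = φ₁ m₁ x := by
        intro x
        rw [← (Equiv.arrowProdEquivProdArrow (Fin n) (fun _ => X₂)
          (fun _ => Y₁ × Y₂ × Z)).symm.sum_comp, Fintype.sum_prod_type]
        have h' : ∀ y : Fin n → X₂, ∑ w : Fin n → Y₁ × Y₂ × Z,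
            φ₁ m₁ x * φ₂ m₂ y * ∏ t, W (x t) (y t) (w t) = φ₁ m₁ x * φ₂ m₂ y := by
          intro y
          rw [← Finset.mul_sum, hW, mul_one]
        refine (Finset.sum_congr rfl fun y _ => h' y).trans ?_
        rw [← Finset.mul_sum, stdSimplex.sum_eq_one, mul_one]
      exact (Finset.sum_congr rfl fun x _ => h x).trans (stdSimplex.sum_eq_one _)

/-- The law of the trace, given the messages. -/
def traceLaw (W : Channel X₁ X₂ Y₁ Y₂ Z) {n L₁ L₂ : ℕ} {c : EncoderType}
    (e₁ : Encoder X₁ Y₁ n L₁ c) (e₂ : Encoder X₂ Y₂ n L₂ c) (m₁ : Fin L₁) (m₂ : Fin L₂) :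
    stdSimplex ℝ (Trace X₁ X₂ Y₁ Y₂ Z n) :=
  ⟨traceProb W e₁ e₂ m₁ m₂, traceProb_mem W e₁ e₂ m₁ m₂⟩

namespace Code

variable {c : EncoderType} {d : DecoderType} {n : ℕ}

/-- The rate `(log L₁) / n` of the first user. -/
def rate₁ (C : Code X₁ X₂ Y₁ Y₂ c d n) : ℝ := Real.log C.L₁ / n

/-- The rate `(log L₂) / n` of the second user. -/
def rate₂ (C : Code X₁ X₂ Y₁ Y₂ c d n) : ℝ := Real.log C.L₂ / n

/-- The joint law of `(M₁, M₂)` and the trace, for independent, uniformly distributed messages. -/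
def law (C : Code X₁ X₂ Y₁ Y₂ c d n) (W : Channel X₁ X₂ Y₁ Y₂ Z) :
    stdSimplex ℝ (Fin C.L₁ × Fin C.L₂ × Trace X₁ X₂ Y₁ Y₂ Z n) :=
  ⟨fun ω => (C.L₁ : ℝ)⁻¹ * (C.L₂ : ℝ)⁻¹ * traceLaw W C.enc₁ C.enc₂ ω.1 ω.2.1 ω.2.2, by
    have h1 : (C.L₁ : ℝ) ≠ 0 := by exact_mod_cast C.L₁_pos.ne'
    have h2 : (C.L₂ : ℝ) ≠ 0 := by exact_mod_cast C.L₂_pos.ne'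
    refine ⟨fun ω => mul_nonneg (by positivity) (stdSimplex.zero_le _ _), ?_⟩
    rw [← Finset.mul_sum, Fintype.sum_prod_type]
    simp_rw [Fintype.sum_prod_type, stdSimplex.sum_eq_one]
    simp
    field_simp⟩

open Classical in
/-- The average probability that at least one of the two users decodes incorrectly. -/
def errorProb (C : Code X₁ X₂ Y₁ Y₂ c d n) (W : Channel X₁ X₂ Y₁ Y₂ Z) : ℝ :=
  ((C.L₁ : ℝ) * (C.L₂ : ℝ))⁻¹ * ∑ m₁ : Fin C.L₁, ∑ m₂ : Fin C.L₂,
    ∑ a : Trace X₁ X₂ Y₁ Y₂ Z n with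
      C.dec₂.decode m₂ a.x₂ a.y₂ ≠ m₁ ∨ C.dec₁.decode m₁ a.x₁ a.y₁ ≠ m₂,
      traceLaw W C.enc₁ C.enc₂ m₁ m₂ a

/-- The leakage `I(M₁; Zⁿ)`. -/
def leakage₁ (C : Code X₁ X₂ Y₁ Y₂ c d n) (W : Channel X₁ X₂ Y₁ Y₂ Z) : ℝ :=
  mutualInfo (stdSimplex.map (fun ω => (ω.1, ω.2.2.z)) (C.law W))

/-- The leakage `I(M₂; Zⁿ)`. -/
def leakage₂ (C : Code X₁ X₂ Y₁ Y₂ c d n) (W : Channel X₁ X₂ Y₁ Y₂ Z) : ℝ :=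
  mutualInfo (stdSimplex.map (fun ω => (ω.2.1, ω.2.2.z)) (C.law W))

end Code

/-- The bound on the leakage at block length `n`: `τ n` for strong and `n τ n` for weak secrecy. -/
def SecrecyType.bound (b : SecrecyType) (τ : ℕ → ℝ) (n : ℕ) : ℝ :=
  match b with
  | .strong => τ n
  | .weak => n * τ n

/-- Achievability of a rate pair under the (strong or weak) individual secrecy constraint, by
codes with the given types of encoders and decoders. -/
def IndividuallyAchievable (W : Channel X₁ X₂ Y₁ Y₂ Z)
    (b : SecrecyType) (c : EncoderType) (d : DecoderType) (R : ℝ × ℝ) : Prop :=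
  ∃ (C : (n : ℕ) → Code X₁ X₂ Y₁ Y₂ c d n) (ε τ : ℕ → ℝ),
    Tendsto ε atTop (𝓝 0) ∧ Tendsto τ atTop (𝓝 0) ∧
    Tendsto (fun n => (C n).rate₁) atTop (𝓝 R.1) ∧
    Tendsto (fun n => (C n).rate₂) atTop (𝓝 R.2) ∧
    ∀ n, 1 ≤ n → (C n).errorProb W ≤ ε n ∧
      (C n).leakage₁ W ≤ b.bound τ n ∧ (C n).leakage₂ W ≤ b.bound τ n

/-- The individual secrecy capacity region `𝒞_{I,b,c,d}` of the channel `W`. -/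
def individualCapacityRegion (W : Channel X₁ X₂ Y₁ Y₂ Z)
    (b : SecrecyType) (c : EncoderType) (d : DecoderType) : Set (ℝ × ℝ) :=
  {R | IndividuallyAchievable W b c d R}

end Law

section Additive

variable {F : Type*} [Field F] [Fintype F]

/-- The additive two-way wiretap channel `Y₁ = a₁ X₁ + b₁ X₂ + N₁`, `Y₂ = a₂ X₁ + b₂ X₂ + N₂`,
`Z = a₃ X₁ + b₃ X₂ + N₃`, where `N` is the joint law of the noises `(N₁, N₂, N₃)`. -/
def additiveChannel (a₁ b₁ a₂ b₂ a₃ b₃ : F) (N : stdSimplex ℝ (F × F × F)) :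
    Channel F F F F F :=
  fun x₁ x₂ => stdSimplex.map (fun ν : F × F × F =>
    (a₁ * x₁ + b₁ * x₂ + ν.1, a₂ * x₁ + b₂ * x₂ + ν.2.1, a₃ * x₁ + b₃ * x₂ + ν.2.2)) N

/-- The law of `N₁`. -/
def noise₁ (N : stdSimplex ℝ (F × F × F)) : stdSimplex ℝ F := stdSimplex.map (fun ν => ν.1) N

/-- The law of `N₂`. -/
def noise₂ (N : stdSimplex ℝ (F × F × F)) : stdSimplex ℝ F := stdSimplex.map (fun ν => ν.2.1) N

/-- The law of `N₃`. -/
def noise₃ (N : stdSimplex ℝ (F × F × F)) : stdSimplex ℝ F := stdSimplex.map (fun ν => ν.2.2) N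

/-- The region `𝒜_O` of the pairs of nonnegative rates with `R₁ ≤ log q - H(N₂)` and
`R₂ ≤ log q - H(N₁)`. -/
def outerRegion (N : stdSimplex ℝ (F × F × F)) : Set (ℝ × ℝ) :=
  {R | 0 ≤ R.1 ∧ 0 ≤ R.2 ∧
    R.1 ≤ Real.log (Fintype.card F) - entropy (noise₂ N) ∧
    R.2 ≤ Real.log (Fintype.card F) - entropy (noise₁ N)}

end Additive

end

end TwoWayWiretap

/-! Each user knows its own input and can subtract it, so User 2 effectively sees `a₂ X₁ + N₂` and
User 1 sees `b₁ X₂ + N₁`, channels with capacities `C₁ = log q - H(N₂)` and `C₂ = log q - H(N₁)`.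
The theorem says that these are the only limits when `C₃ = log q - H(N₃)` is at most both of them.

Achievability: draw a random codebook for each user, indexed by a message (rate `rᵢ`) and a local
dither (rate `sᵢ`). Maximum likelihood decoding of message and dither succeeds if `rᵢ + sᵢ < Cᵢ`
(`UniformDifferences.sum_mlError_le`). For fixed `M₁`, the word seen by the eavesdropper is still
indexed by `M₂` and both dithers; if `r₂ + s₁ + s₂ > C₃` these randomize enough to make `Z^n` nearly
uniform in divergence (`UniformDifferences.sum_divUniform_le`), which bounds `I(M₁;Z^n)`.
Symmetrically for `M₂`. Thus each message helps to mask the other. Taking `rᵢ + sᵢ` just below `Cᵢ`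
satisfies everything because `C₃ ≤ C₁, C₂` (`exists_rates`). If `C₃ = 0`, the noise `N₃` is uniform
and nothing leaks. Averaging over codebooks uses only that differences of two distinct words are
uniform, and the exponential estimates are Chernoff bounds. The codes are nonadaptive with decoders
of the second type, hence convert to every type.

Converse: secrecy plays no role. Nonadaptive encoders are special adaptive ones. Replacing the law
of `N₂` by the uniform one makes what User 2 observes independent of `M₁`, so a correct guess then
has probability `1 / L₁`. Changing back costs a factor `exp (n γ)` except where the likelihood ratio
of the noise is larger, an event that is exponentially rare for `γ > C₁`, even under adaptation, as
each noise symbol is fresh (`sum_traceProb_decode_le`). Exchanging the users gives the other bound.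
-/

namespace TwoWayWiretap

noncomputable section

/-! ### Laws on finite sets: images, products, entropy and divergence from uniform. -/

section FiniteLaws

variable {α β : Type*} [Fintype α] [Fintype β]

theorem sum_map_mul (f : α → β) (P : stdSimplex ℝ α) (g : β → ℝ) :
    ∑ b, stdSimplex.map f P b * g b = ∑ a, P a * g (f a) := by
  classical
  simp only [stdSimplex.map_coe, FunOnFinite.linearMap_apply_apply, Finset.sum_mul]
  rw [← Finset.sum_fiberwise Finset.univ f]
  refine Finset.sum_congr rfl fun b _ => Finset.sum_congr rfl fun a ha => ?_
  rw [(Finset.mem_filter.1 ha).2]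

open Classical in
theorem map_apply_eq_sum (f : α → β) (P : stdSimplex ℝ α) (b : β) :
    stdSimplex.map f P b = ∑ a, P a * if f a = b then 1 else 0 := by
  rw [← sum_map_mul f P fun b' => if b' = b then (1 : ℝ) else 0]
  simp

/-- The law of `n` independent symbols of law `P`. -/
def iid (P : stdSimplex ℝ α) (n : ℕ) : stdSimplex ℝ (Fin n → α) :=
  ⟨fun v => ∏ t, P (v t), fun _ => Finset.prod_nonneg fun _ _ => stdSimplex.zero_le _ _, by
    classical
    rw [← Fintype.prod_sum fun (_ : Fin n) b => P b]
    simp⟩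

theorem iid_apply (P : stdSimplex ℝ α) {n : ℕ} (v : Fin n → α) : iid P n v = ∏ t, P (v t) := rfl

theorem sum_iid_mul_prod (P : stdSimplex ℝ α) (n : ℕ) (h : α → ℝ) :
    ∑ v, iid P n v * ∏ t, h (v t) = (∑ a, P a * h a) ^ n := by
  classical
  simp_rw [iid_apply, ← Finset.prod_mul_distrib]
  rw [← Fintype.prod_sum fun (_ : Fin n) b => P b * h b]
  simp

theorem map_iid (f : α → β) (P : stdSimplex ℝ α) (n : ℕ) :
    stdSimplex.map (fun (w : Fin n → α) t => f (w t)) (iid P n) = iid (stdSimplex.map f P) n := by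
  classical
  ext v
  rw [map_apply_eq_sum, iid_apply]
  simp_rw [map_apply_eq_sum]
  rw [Fintype.prod_sum fun (t : Fin n) a => P a * if f a = v t then 1 else 0]
  refine Finset.sum_congr rfl fun w _ => ?_
  rw [Finset.prod_mul_distrib, iid_apply]
  congr 1
  rw [Finset.prod_ite_zero]
  simp [funext_iff]

/-- The Chernoff argument: the moment generating function is 1 at 0 and its derivative there is the
mean, which is negative. The bound `s ≤ 1` is what `min_one_le_rpow` and `log_one_add_le_rpow_div`
require. -/
theorem exists_sum_mul_exp_lt_one (P : stdSimplex ℝ α) (l : α → ℝ) (h : ∑ a, P a * l a < 0) :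
    ∃ s : ℝ, 0 < s ∧ s ≤ 1 ∧ ∑ a, P a * Real.exp (s * l a) < 1 := by
  have hd : HasDerivAt (fun s : ℝ => ∑ a, P a * Real.exp (s * l a)) (∑ a, P a * l a) 0 := by
    refine HasDerivAt.fun_sum fun a _ => HasDerivAt.const_mul _ ?_
    simpa using ((hasDerivAt_id (0 : ℝ)).mul_const (l a)).exp
  have hev := (hasDerivAt_iff_tendsto_slope.1 hd).eventually_lt_const h
  have hev' : ∀ᶠ s in 𝓝[>] (0 : ℝ), slope (fun s : ℝ => ∑ a, P a * Real.exp (s * l a)) 0 s < 0 :=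
    hev.filter_mono (nhdsWithin_mono _ fun x hx => ne_of_gt hx)
  have hIoc : ∀ᶠ s in 𝓝[>] (0 : ℝ), s ∈ Set.Ioc (0 : ℝ) 1 := Ioc_mem_nhdsGT one_pos
  obtain ⟨s, hs, hs0, hs1⟩ := (hev'.and hIoc).exists
  refine ⟨s, hs0, hs1, ?_⟩
  rw [slope_def_field, sub_zero, div_lt_iff₀ hs0] at hs
  simpa using hs

theorem sum_mul_log_eq (P : stdSimplex ℝ α) {c : ℝ} (hc : 0 < c) :
    ∑ a, P a * Real.log (c * P a) = Real.log c - entropy P := by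
  have h : ∀ a, P a * Real.log (c * P a) = P a * Real.log c - Real.negMulLog (P a) := by
    intro a
    rcases eq_or_ne (P a) 0 with h0 | h0
    · simp [h0]
    · rw [Real.log_mul hc.ne' h0, Real.negMulLog]; ring
  simp_rw [h, Finset.sum_sub_distrib, ← Finset.sum_mul, stdSimplex.sum_eq_one, one_mul]
  rfl

theorem nonempty_of_stdSimplex (P : stdSimplex ℝ α) : Nonempty α := by
  by_contra h
  rw [not_nonempty_iff] at h
  simpa using stdSimplex.sum_eq_one P

/-- This is `1 - 1/x ≤ log x` at `x = |α| P a`, multiplied by `P a`. Summed over `a` it gives the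
maximum entropy bound, and its strictness for `x ≠ 1` gives the equality case. -/
theorem sub_inv_card_le_mul_log (P : stdSimplex ℝ α) (a : α) :
    P a - (Fintype.card α : ℝ)⁻¹ ≤ P a * Real.log (Fintype.card α * P a) := by
  have hc : 0 < (Fintype.card α : ℝ) := by
    have := nonempty_of_stdSimplex P
    exact_mod_cast Fintype.card_pos
  rcases (stdSimplex.zero_le P a).eq_or_lt with h | h
  · rw [← h]; simp
  · have h1 := Real.one_sub_inv_le_log_of_pos (mul_pos hc h)
    have h2 := mul_le_mul_of_nonneg_left h1 h.le
    refine le_trans (le_of_eq ?_) h2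
    field_simp

theorem entropy_le_log_card (P : stdSimplex ℝ α) : entropy P ≤ Real.log (Fintype.card α) := by
  have hn := nonempty_of_stdSimplex P
  have hc : 0 < (Fintype.card α : ℝ) := by exact_mod_cast Fintype.card_pos
  have h := Finset.sum_le_sum fun a (_ : a ∈ Finset.univ) => sub_inv_card_le_mul_log P a
  rw [sum_mul_log_eq P hc, Finset.sum_sub_distrib, stdSimplex.sum_eq_one] at h
  simp at h
  linarith

theorem eq_inv_card_of_log_card_le_entropy (P : stdSimplex ℝ α)
    (h : Real.log (Fintype.card α) ≤ entropy P) (a : α) : P a = (Fintype.card α : ℝ)⁻¹ := by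
  have hn := nonempty_of_stdSimplex P
  have hc : 0 < (Fintype.card α : ℝ) := by exact_mod_cast Fintype.card_pos
  have h0 : ∑ a, (P a * Real.log (Fintype.card α * P a) - (P a - (Fintype.card α : ℝ)⁻¹)) = 0 := by
    refine le_antisymm ?_
      (Finset.sum_nonneg fun a _ => sub_nonneg.2 (sub_inv_card_le_mul_log P a))
    rw [Finset.sum_sub_distrib, sum_mul_log_eq P hc, Finset.sum_sub_distrib,
      stdSimplex.sum_eq_one]
    simp
    linarith
  have h1 := (Finset.sum_eq_zero_iff_of_nonneg
    fun a _ => sub_nonneg.2 (sub_inv_card_le_mul_log P a)).1 h0 a (Finset.mem_univ a)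
  rcases (stdSimplex.zero_le P a).eq_or_lt with hp | hp
  · rw [← hp] at h1
    simp at h1
  · by_contra hne
    have hx : 0 < ((Fintype.card α : ℝ) * P a)⁻¹ := by positivity
    have h2 := Real.log_lt_sub_one_of_pos hx
      (fun hh => hne (eq_inv_of_mul_eq_one_right (inv_eq_one.1 hh)))
    rw [Real.log_inv] at h2
    have h3 := mul_lt_mul_of_pos_left h2 hp
    have h4 : P a * (((Fintype.card α : ℝ) * P a)⁻¹ - 1) = (Fintype.card α : ℝ)⁻¹ - P a := by
      field_simp
    linarith

/-- The divergence of `P` from the uniform distribution, `log |α| - H(P)`. -/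
def divUniform (P : stdSimplex ℝ α) : ℝ := Real.log (Fintype.card α) - entropy P

theorem divUniform_nonneg (P : stdSimplex ℝ α) : 0 ≤ divUniform P :=
  sub_nonneg.2 (entropy_le_log_card P)

/-- If the conditional laws of `B` given a uniform `A` are close to uniform, then `I(A;B)` is
small. -/
theorem mutualInfo_le_of_uniform {P : stdSimplex ℝ (α × β)} [Nonempty α]
    (Q : α → stdSimplex ℝ β) (hP : ∀ a b, P (a, b) = (Fintype.card α : ℝ)⁻¹ * Q a b) :
    mutualInfo P ≤ (Fintype.card α : ℝ)⁻¹ * ∑ a, divUniform (Q a) := by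
  classical
  have hc : 0 < (Fintype.card α : ℝ) := by exact_mod_cast Fintype.card_pos
  have hfst : ∀ a, stdSimplex.map Prod.fst P a = (Fintype.card α : ℝ)⁻¹ := by
    intro a
    rw [map_apply_eq_sum, Fintype.sum_prod_type, Finset.sum_eq_single a]
    · simp [hP, ← Finset.mul_sum]
    · intro a' _ h
      simp [h]
    · simp
  have h1 : entropy (stdSimplex.map Prod.fst P) = Real.log (Fintype.card α) := by
    simp [entropy, hfst, Real.negMulLog, Real.log_inv]
  have h2 := entropy_le_log_card (stdSimplex.map Prod.snd P)
  have h3 : entropy P = Real.log (Fintype.card α) + (Fintype.card α : ℝ)⁻¹ * ∑ a, entropy (Q a) := by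
    simp only [entropy]
    rw [Fintype.sum_prod_type]
    simp_rw [hP, Real.negMulLog_mul, Finset.sum_add_distrib, ← Finset.mul_sum, ← Finset.sum_mul,
      stdSimplex.sum_eq_one]
    congr 1
    simp [Real.negMulLog, Real.log_inv]
  have h4 : (Fintype.card α : ℝ)⁻¹ * ∑ a, divUniform (Q a)
      = Real.log (Fintype.card β) - (Fintype.card α : ℝ)⁻¹ * ∑ a, entropy (Q a) := by
    simp only [divUniform, Finset.sum_sub_distrib]
    simp
    field_simp
  rw [mutualInfo, h1, h3, h4]
  linarith

end FiniteLaws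

/-! ### Random codebooks: resolvability and maximum likelihood decoding. -/

section RandomCoding

variable {G κ V : Type*} [Fintype G] [Fintype V] [AddCommGroup V]

/-- The differences of distinct code words of the random codebook `x g`, with `g` uniform on `G`,
are uniform on `V`. -/
def UniformDifferences (x : G → κ → V) : Prop :=
  ∀ i j, i ≠ j → ∀ f : V → ℝ,
    ∑ g, f (x g i - x g j) = Fintype.card G / Fintype.card V * ∑ v, f v

/-- Reindexing `G` by the shifts shows that the sum is invariant under translating `f`; averaging
over all translations `w` then yields the uniform mean of `f`. -/
theorem UniformDifferences.of_shift {x : G → κ → V}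
    (h : ∀ i j, i ≠ j → ∀ w : V, ∃ e : G ≃ G, ∀ g, x (e g) i - x (e g) j = x g i - x g j + w) :
    UniformDifferences x := by
  intro i j hij f
  have hV : (Fintype.card V : ℝ) ≠ 0 := by exact_mod_cast Fintype.card_ne_zero
  have h1 : ∀ w : V, ∑ g, f (x g i - x g j + w) = ∑ g, f (x g i - x g j) := by
    intro w
    obtain ⟨e, he⟩ := h i j hij w
    rw [← e.sum_comp fun g => f (x g i - x g j)]
    simp_rw [he]
  have h2 : ∑ w : V, ∑ g, f (x g i - x g j + w) = Fintype.card G * ∑ v, f v := by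
    rw [Finset.sum_comm]
    have : ∀ g, ∑ w, f (x g i - x g j + w) = ∑ v, f v := fun g =>
      Equiv.sum_comp (Equiv.addLeft (x g i - x g j)) f
    simp [this]
  simp_rw [h1] at h2
  simp at h2
  field_simp
  linarith

variable [Fintype κ]

open Classical in
theorem UniformDifferences.sum_interference {x : G → κ → V} (hx : UniformDifferences x)
    (N : stdSimplex ℝ V) (u : κ) (v : V) :
    ∑ g, ∑ u' with u' ≠ u, N (x g u - x g u' + v)
      = (Fintype.card κ - 1) * (Fintype.card G / Fintype.card V) := by
  rw [Finset.sum_comm]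
  have h1 : ∀ u' ∈ Finset.univ.filter (fun u' => u' ≠ u), ∑ g, N (x g u - x g u' + v)
      = Fintype.card G / Fintype.card V := by
    intro u' hu'
    have h2 : ∑ w, N (w + v) = 1 :=
      (Equiv.sum_comp (Equiv.addRight v) fun w => N w).trans (stdSimplex.sum_eq_one N)
    rw [hx u u' (Ne.symm (Finset.mem_filter.1 hu').2) fun w => N (w + v), h2, mul_one]
  rw [Finset.sum_congr rfl h1, Finset.sum_const, Finset.filter_ne', nsmul_eq_mul,
    Finset.card_erase_of_mem (Finset.mem_univ u), Finset.card_univ,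
    Nat.cast_sub (Fintype.card_pos_iff.2 ⟨u⟩)]
  simp

/-- The law of `x U + N` for a uniform `U`. -/
def noisyLaw [Nonempty κ] (x : κ → V) (N : stdSimplex ℝ V) : stdSimplex ℝ V :=
  ⟨fun z => (Fintype.card κ : ℝ)⁻¹ * ∑ u, N (z - x u),
    fun _ => mul_nonneg (by positivity) (Finset.sum_nonneg fun _ _ => stdSimplex.zero_le _ _), by
    rw [← Finset.mul_sum, Finset.sum_comm]
    have : ∀ u, ∑ z, N (z - x u) = 1 := fun u =>
      (Equiv.sum_comp (Equiv.subRight (x u)) fun w => N w).trans (stdSimplex.sum_eq_one N)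
    simp [this]⟩

theorem noisyLaw_apply [Nonempty κ] (x : κ → V) (N : stdSimplex ℝ V) (z : V) :
    noisyLaw x N z = (Fintype.card κ : ℝ)⁻¹ * ∑ u, N (z - x u) := rfl

theorem sum_noisyLaw_mul [Nonempty κ] (x : κ → V) (N : stdSimplex ℝ V) (f : V → ℝ) :
    ∑ z, noisyLaw x N z * f z = (Fintype.card κ : ℝ)⁻¹ * ∑ u, ∑ v, N v * f (x u + v) := by
  simp_rw [noisyLaw_apply, mul_assoc, ← Finset.mul_sum, Finset.sum_mul]
  rw [Finset.sum_comm]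
  congr 1
  refine Finset.sum_congr rfl fun u _ => ?_
  rw [← Equiv.sum_comp (Equiv.addLeft (x u)) fun z => N (z - x u) * f z]
  simp

theorem divUniform_noisyLaw_eq_zero [Nonempty κ] (x : κ → V) (N : stdSimplex ℝ V)
    (hN : ∀ v, N v = (Fintype.card V : ℝ)⁻¹) : divUniform (noisyLaw x N) = 0 := by
  have h : ∀ z, noisyLaw x N z = (Fintype.card V : ℝ)⁻¹ := by
    intro z
    simp [noisyLaw_apply, hN]
  simp [divUniform, entropy, h, Real.negMulLog, Real.log_inv]

/-- Jensen's inequality conditioned on the transmitted index `u`: the density of the output relative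
to uniform is its own contribution `A` plus interference `B g` from the other words, and `B` has
mean at most 1. -/
theorem UniformDifferences.sum_divUniform_le [Nonempty κ] {x : G → κ → V}
    (hx : UniformDifferences x) (N : stdSimplex ℝ V) :
    ∑ g, divUniform (noisyLaw (x g) N) ≤ Fintype.card G *
      ∑ v, N v * Real.log (1 + Fintype.card V * N v / Fintype.card κ) := by
  classical
  have hV : 0 < (Fintype.card V : ℝ) := by exact_mod_cast Fintype.card_pos
  have hK : 0 < (Fintype.card κ : ℝ) := by exact_mod_cast Fintype.card_pos
  have h1 : ∀ g, divUniform (noisyLaw (x g) N) = (Fintype.card κ : ℝ)⁻¹ * ∑ u, ∑ v, N v *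
      Real.log (Fintype.card V * noisyLaw (x g) N (x g u + v)) := by
    intro g
    rw [divUniform, ← sum_mul_log_eq _ hV,
      sum_noisyLaw_mul (x g) N fun z => Real.log (Fintype.card V * noisyLaw (x g) N z)]
  have h2 : ∀ u v, ∑ g, N v * Real.log (Fintype.card V * noisyLaw (x g) N (x g u + v))
      ≤ Fintype.card G * (N v * Real.log (1 + Fintype.card V * N v / Fintype.card κ)) := by
    intro u v
    rcases (stdSimplex.zero_le N v).eq_or_lt with h0 | h0
    · simp [← h0]
    rw [← Finset.mul_sum, mul_left_comm]
    refine mul_le_mul_of_nonneg_left ?_ h0.le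
    set A := (Fintype.card V : ℝ) * N v / Fintype.card κ with hA
    have hA0 : 0 < A := by positivity
    let B : G → ℝ := fun g => (Fintype.card V : ℝ) / Fintype.card κ *
      ∑ u' with u' ≠ u, N (x g u - x g u' + v)
    have hB0 : ∀ g, 0 ≤ B g := fun g =>
      mul_nonneg (by positivity) (Finset.sum_nonneg fun _ _ => stdSimplex.zero_le _ _)
    have hQ : ∀ g, (Fintype.card V : ℝ) * noisyLaw (x g) N (x g u + v) = A + B g := by
      intro g
      rw [noisyLaw_apply, ← Finset.add_sum_erase _ _ (Finset.mem_univ u), ← Finset.filter_ne']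
      simp only [B, hA, add_sub_cancel_left, add_sub_right_comm]
      field_simp
    -- The tangent line of `log` at `1 + A` lies above it; its linear term has nonpositive mean over
    -- `g` because `B` has mean at most 1.
    have hlog : ∀ g, Real.log (Fintype.card V * noisyLaw (x g) N (x g u + v))
        ≤ Real.log (1 + A) + ((A + B g) / (1 + A) - 1) := by
      intro g
      have hp : 0 < A + B g := by linarith [hB0 g]
      have h3 := Real.log_le_sub_one_of_pos (show 0 < (A + B g) / (1 + A) by positivity)
      rw [Real.log_div hp.ne' (by positivity)] at h3
      rw [hQ]
      linarith
    have hBsum : ∑ g, B g ≤ Fintype.card G := by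
      rw [← Finset.mul_sum, hx.sum_interference]
      have : (Fintype.card V : ℝ) / Fintype.card κ *
          ((Fintype.card κ - 1) * (Fintype.card G / Fintype.card V))
          = Fintype.card G - Fintype.card G / Fintype.card κ := by field_simp
      rw [this]
      have : 0 ≤ (Fintype.card G : ℝ) / Fintype.card κ := by positivity
      linarith
    refine (Finset.sum_le_sum fun g _ => hlog g).trans ?_
    rw [Finset.sum_add_distrib, Finset.sum_sub_distrib, ← Finset.sum_div, Finset.sum_add_distrib]
    simp only [Finset.sum_const, Finset.card_univ, nsmul_eq_mul, mul_one]
    have : ((Fintype.card G : ℝ) * A + ∑ g, B g) / (1 + A) ≤ Fintype.card G := by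
      rw [div_le_iff₀ (by positivity)]
      linarith
    linarith
  simp_rw [h1]
  rw [← Finset.mul_sum, Finset.sum_comm]
  have h3 : ∀ u, ∑ g, ∑ v, N v * Real.log (Fintype.card V * noisyLaw (x g) N (x g u + v))
      ≤ Fintype.card G * ∑ v, N v * Real.log (1 + Fintype.card V * N v / Fintype.card κ) := by
    intro u
    rw [Finset.sum_comm, Finset.mul_sum]
    exact Finset.sum_le_sum fun v _ => h2 u v
  refine (mul_le_mul_of_nonneg_left (Finset.sum_le_sum fun u _ => h3 u) (by positivity)).trans ?_
  simp only [Finset.sum_const, Finset.card_univ, nsmul_eq_mul]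
  rw [inv_mul_cancel_left₀ hK.ne']

/-- Maximum likelihood decoding of `u` from `x u + N`. -/
def mlDecode [Nonempty κ] (x : κ → V) (N : stdSimplex ℝ V) (y : V) : κ :=
  (Finset.exists_max_image Finset.univ (fun u => N (y - x u)) Finset.univ_nonempty).choose

theorem le_mlDecode [Nonempty κ] (x : κ → V) (N : stdSimplex ℝ V) (y : V) (u : κ) :
    N (y - x u) ≤ N (y - x (mlDecode x N y)) :=
  (Finset.exists_max_image Finset.univ (fun u => N (y - x u))
    Finset.univ_nonempty).choose_spec.2 u (Finset.mem_univ u)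

/-- The random coding bound on the error probability of a code with `K` words. -/
def mlBound {V : Type*} [Fintype V] (P : stdSimplex ℝ V) (K : ℕ) : ℝ :=
  ∑ v, P v * min 1 (((K : ℝ) - 1) / (Fintype.card V * P v))

open Classical in
/-- The error probability of maximum likelihood decoding. -/
def mlError [Nonempty κ] (x : κ → V) (N : stdSimplex ℝ V) : ℝ :=
  (Fintype.card κ : ℝ)⁻¹ * ∑ u, ∑ v, N v * if mlDecode x N (x u + v) ≠ u then 1 else 0

theorem mlError_nonneg [Nonempty κ] (x : κ → V) (N : stdSimplex ℝ V) : 0 ≤ mlError x N :=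
  mul_nonneg (by positivity) (Finset.sum_nonneg fun _ _ => Finset.sum_nonneg fun _ _ =>
    mul_nonneg (stdSimplex.zero_le _ _) (by split_ifs <;> simp))

theorem UniformDifferences.sum_mlError_le [Nonempty κ] {x : G → κ → V}
    (hx : UniformDifferences x) (N : stdSimplex ℝ V) :
    ∑ g, mlError (x g) N ≤ Fintype.card G * mlBound N (Fintype.card κ) := by
  classical
  have hV : 0 < (Fintype.card V : ℝ) := by exact_mod_cast Fintype.card_pos
  have hK : 0 < (Fintype.card κ : ℝ) := by exact_mod_cast Fintype.card_pos
  have h2 : ∀ u v, ∑ g, N v * (if mlDecode (x g) N (x g u + v) ≠ u then (1 : ℝ) else 0)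
      ≤ Fintype.card G * (N v * min 1 ((Fintype.card κ - 1) / (Fintype.card V * N v))) := by
    intro u v
    rcases (stdSimplex.zero_le N v).eq_or_lt with h0 | h0
    · simp [← h0]
    rw [← Finset.mul_sum, mul_left_comm]
    refine mul_le_mul_of_nonneg_left ?_ h0.le
    rw [mul_min_of_nonneg _ _ (by positivity)]
    refine le_min ?_ ?_
    · refine (Finset.sum_le_sum fun g _ => show _ ≤ (1 : ℝ) by split_ifs <;> simp).trans ?_
      simp
    -- Union bound: an error exhibits a wrong word whose likelihood is at least `N v`, so the
    -- indicator is at most the total likelihood of the wrong words divided by `N v`.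
    · have h3 : ∀ g, (if mlDecode (x g) N (x g u + v) ≠ u then (1 : ℝ) else 0)
          ≤ (∑ u' with u' ≠ u, N (x g u - x g u' + v)) / N v := by
        intro g
        have hs : ∀ u' ∈ Finset.univ.filter (fun u' => u' ≠ u), 0 ≤ N (x g u - x g u' + v) :=
          fun _ _ => stdSimplex.zero_le _ _
        split_ifs with h
        · rw [le_div_iff₀ h0, one_mul]
          have h4 := le_mlDecode (x g) N (x g u + v) u
          rw [add_sub_cancel_left, add_sub_right_comm] at h4
          exact h4.trans (Finset.single_le_sum hs (Finset.mem_filter.2 ⟨Finset.mem_univ _, h⟩))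
        · exact div_nonneg (Finset.sum_nonneg hs) h0.le
      refine (Finset.sum_le_sum fun g _ => h3 g).trans ?_
      rw [← Finset.sum_div, hx.sum_interference]
      apply le_of_eq
      field_simp
  simp only [mlError, mlBound]
  rw [← Finset.mul_sum, Finset.sum_comm]
  have h3 : ∀ u, ∑ g, ∑ v, N v * (if mlDecode (x g) N (x g u + v) ≠ u then (1 : ℝ) else 0)
      ≤ Fintype.card G * ∑ v, N v * min 1 ((Fintype.card κ - 1) / (Fintype.card V * N v)) := by
    intro u
    rw [Finset.sum_comm, Finset.mul_sum]
    exact Finset.sum_le_sum fun v _ => h2 u v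
  refine (mul_le_mul_of_nonneg_left (Finset.sum_le_sum fun u _ => h3 u) (by positivity)).trans ?_
  simp only [Finset.sum_const, Finset.card_univ, nsmul_eq_mul]
  rw [inv_mul_cancel_left₀ hK.ne']

end RandomCoding

/-! ### Exponential decay of the random coding bounds for i.i.d. noise. -/

section Asymptotics

variable {F : Type*} [Fintype F]

/-- Passing to an `s`-th power makes the bound a product over coordinates, so its mean under i.i.d.
noise is an `n`-th power. -/
theorem min_one_le_rpow {x s : ℝ} (hx : 0 ≤ x) (hs : 0 < s) (hs1 : s ≤ 1) : min 1 x ≤ x ^ s := by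
  rcases le_total x 1 with h | h
  · rcases hx.eq_or_lt with h0 | h0
    · rw [← h0, Real.zero_rpow hs.ne']
      exact min_le_right _ _
    · refine (min_le_right _ _).trans ?_
      simpa using Real.rpow_le_rpow_of_exponent_ge h0 h hs1
  · exact (min_le_left _ _).trans (Real.one_le_rpow h hs.le)

/-- Subadditivity of `t ↦ t ^ s` gives `s log (1 + x) ≤ log (1 + x ^ s) ≤ x ^ s`. -/
theorem log_one_add_le_rpow_div {x s : ℝ} (hx : 0 ≤ x) (hs : 0 < s) (hs1 : s ≤ 1) :
    Real.log (1 + x) ≤ x ^ s / s := by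
  have h0 : 0 ≤ x ^ s := Real.rpow_nonneg hx s
  have h1 : (1 + x) ^ s ≤ 1 + x ^ s := by
    simpa using Real.rpow_add_le_add_rpow zero_le_one hx hs.le hs1
  have h2 : Real.log ((1 + x) ^ s) ≤ Real.log (1 + x ^ s) :=
    Real.log_le_log (Real.rpow_pos_of_pos (by linarith) s) h1
  rw [Real.log_rpow (by linarith)] at h2
  have h3 := Real.log_le_sub_one_of_pos (show 0 < 1 + x ^ s by linarith)
  rw [le_div_iff₀ hs]
  linarith

/-- `log q - H(P)`, the capacity of the additive channel whose noise has law `P`. -/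
abbrev capacity (P : stdSimplex ℝ F) : ℝ := divUniform P

theorem sum_mul_log_sub (P : stdSimplex ℝ F) (ρ : ℝ) :
    ∑ a, P a * (Real.log (Fintype.card F * P a) - ρ) = capacity P - ρ := by
  have hn := nonempty_of_stdSimplex P
  have hc : 0 < (Fintype.card F : ℝ) := by exact_mod_cast Fintype.card_pos
  simp_rw [mul_sub, Finset.sum_sub_distrib]
  rw [sum_mul_log_eq P hc, ← Finset.sum_mul, stdSimplex.sum_eq_one, one_mul]
  rfl

theorem prod_exp_mul_log_sub {P : stdSimplex ℝ F} {n : ℕ} {v : Fin n → F} (hv : ∀ t, 0 < P (v t))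
    (s ρ : ℝ) :
    ∏ t, Real.exp (s * (Real.log (Fintype.card F * P (v t)) - ρ))
      = (Fintype.card (Fin n → F) * iid P n v / Real.exp (n * ρ)) ^ s := by
  have hn := nonempty_of_stdSimplex P
  have hc : 0 < (Fintype.card F : ℝ) := by exact_mod_cast Fintype.card_pos
  have h1 : (Fintype.card (Fin n → F) : ℝ) * iid P n v / Real.exp (n * ρ)
      = ∏ t, Real.exp (Real.log (Fintype.card F * P (v t)) - ρ) := by
    simp_rw [Real.exp_sub, Real.exp_log (mul_pos hc (hv _)), Finset.prod_div_distrib,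
      Finset.prod_mul_distrib]
    simp [iid_apply, Real.exp_nat_mul]
  rw [h1, ← Real.finsetProd_rpow _ _ fun _ _ => (Real.exp_pos _).le]
  simp_rw [← Real.exp_mul, mul_comm s]

theorem iid_eq_zero_or_pos (P : stdSimplex ℝ F) {n : ℕ} (v : Fin n → F) :
    iid P n v = 0 ∨ ∀ t, 0 < P (v t) := by
  by_cases h : ∃ t, P (v t) = 0
  · obtain ⟨t, ht⟩ := h
    exact Or.inl (Finset.prod_eq_zero (Finset.mem_univ t) ht)
  · push Not at h
    exact Or.inr fun t => lt_of_le_of_ne (stdSimplex.zero_le _ _) (h t).symm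

/-- The bound on the error probability of a random code with `K` words is small if the rate is
below the capacity. -/
theorem tendsto_mlBound (P : stdSimplex ℝ F) {K : ℕ → ℕ} {c ρ : ℝ} (hK1 : ∀ n, 1 ≤ K n)
    (hK : ∀ n, (K n : ℝ) ≤ c * Real.exp (n * ρ)) (hρ : ρ < capacity P) :
    Tendsto (fun n => mlBound (iid P n) (K n)) atTop (𝓝 0) := by
  have hn := nonempty_of_stdSimplex P
  have hc : 0 < c := by
    have h1 := hK 0
    have h2 : (1 : ℝ) ≤ K 0 := by exact_mod_cast hK1 0
    simp at h1
    linarith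
  -- Decoding fails when the likelihood ratio of the noise falls below `exp (n ρ)`, so the exponent
  -- carries the opposite sign to the one for resolvability.
  have hlt : ∑ a, P a * -(Real.log (Fintype.card F * P a) - ρ) < 0 := by
    simp_rw [mul_neg, Finset.sum_neg_distrib, sum_mul_log_sub]
    linarith
  obtain ⟨s, hs, hs1, hg⟩ := exists_sum_mul_exp_lt_one P _ hlt
  set g := ∑ a, P a * Real.exp (s * -(Real.log (Fintype.card F * P a) - ρ)) with hgdef
  have hg0 : 0 ≤ g := Finset.sum_nonneg fun a _ =>
    mul_nonneg (stdSimplex.zero_le _ _) (Real.exp_pos _).le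
  have hlim : Tendsto (fun n : ℕ => c ^ s * g ^ n) atTop (𝓝 0) := by
    simpa using (tendsto_pow_atTop_nhds_zero_of_lt_one hg0 hg).const_mul (c ^ s)
  have hK0 : ∀ n, 0 ≤ (K n : ℝ) - 1 := fun n => sub_nonneg.2 (by exact_mod_cast hK1 n)
  refine squeeze_zero (fun n => Finset.sum_nonneg fun v _ => mul_nonneg (stdSimplex.zero_le _ _)
    (le_min zero_le_one (div_nonneg (hK0 n) (mul_nonneg (by positivity)
      (stdSimplex.zero_le _ _))))) (fun n => ?_) hlim
  rw [hgdef, ← sum_iid_mul_prod, Finset.mul_sum, mlBound]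
  refine Finset.sum_le_sum fun v _ => ?_
  rcases iid_eq_zero_or_pos P v with h0 | hv
  · simp [h0]
  have hp : 0 < iid P n v := by
    rw [iid_apply]
    exact Finset.prod_pos fun t _ => hv t
  rw [mul_left_comm]
  refine mul_le_mul_of_nonneg_left ?_ hp.le
  have hKn := hK n
  have hV : 0 < (Fintype.card (Fin n → F) : ℝ) := by exact_mod_cast Fintype.card_pos
  refine (min_one_le_rpow (div_nonneg (hK0 n) (by positivity)) hs hs1).trans ?_
  simp_rw [mul_neg, ← neg_mul]
  rw [prod_exp_mul_log_sub hv, Real.rpow_neg (by positivity), ← Real.inv_rpow (by positivity),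
    ← Real.mul_rpow hc.le (by positivity), inv_div, ← mul_div_assoc]
  refine Real.rpow_le_rpow (div_nonneg (hK0 n) (by positivity)) ?_ hs.le
  gcongr
  linarith

/-- The bound on the divergence at the output of a random code with `K` words is small if the
rate is above the capacity. -/
theorem tendsto_resolvabilityBound (P : stdSimplex ℝ F) {K : ℕ → ℕ} {ρ : ℝ}
    (hK : ∀ n : ℕ, Real.exp (n * ρ) ≤ K n) (hρ : capacity P < ρ) :
    Tendsto (fun n => ∑ v, iid P n v *
      Real.log (1 + Fintype.card (Fin n → F) * iid P n v / K n)) atTop (𝓝 0) := by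
  have hn := nonempty_of_stdSimplex P
  have hlt : ∑ a, P a * (Real.log (Fintype.card F * P a) - ρ) < 0 := by
    rw [sum_mul_log_sub]
    linarith
  obtain ⟨s, hs, hs1, hg⟩ := exists_sum_mul_exp_lt_one P _ hlt
  set g := ∑ a, P a * Real.exp (s * (Real.log (Fintype.card F * P a) - ρ)) with hgdef
  have hg0 : 0 ≤ g := Finset.sum_nonneg fun a _ =>
    mul_nonneg (stdSimplex.zero_le _ _) (Real.exp_pos _).le
  have hlim : Tendsto (fun n : ℕ => g ^ n / s) atTop (𝓝 0) := by
    simpa using (tendsto_pow_atTop_nhds_zero_of_lt_one hg0 hg).div_const s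
  have hx : ∀ n v, 0 ≤ (Fintype.card (Fin n → F) : ℝ) * iid P n v / K n := fun n v =>
    div_nonneg (mul_nonneg (by positivity) (stdSimplex.zero_le _ _)) (by positivity)
  refine squeeze_zero (fun n => Finset.sum_nonneg fun v _ => mul_nonneg (stdSimplex.zero_le _ _)
    (Real.log_nonneg (by linarith [hx n v]))) (fun n => ?_) hlim
  rw [hgdef, ← sum_iid_mul_prod, Finset.sum_div]
  refine Finset.sum_le_sum fun v _ => ?_
  rcases iid_eq_zero_or_pos P v with h0 | hv
  · simp [h0]
  have hp : 0 < iid P n v := by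
    rw [iid_apply]
    exact Finset.prod_pos fun t _ => hv t
  rw [mul_div_assoc (iid P n v)]
  refine mul_le_mul_of_nonneg_left ?_ hp.le
  refine (log_one_add_le_rpow_div (hx n v) hs hs1).trans ?_
  rw [prod_exp_mul_log_sub hv]
  gcongr
  exact hK n

/-- The size of a message set of rate about `r`. -/
def messageCount (r : ℝ) (n : ℕ) : ℕ := ⌈Real.exp (n * r)⌉₊

theorem exp_le_messageCount (r : ℝ) (n : ℕ) : Real.exp (n * r) ≤ messageCount r n := Nat.le_ceil _

theorem messageCount_pos (r : ℝ) (n : ℕ) : 0 < messageCount r n := Nat.ceil_pos.2 (Real.exp_pos _)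

theorem messageCount_le {r : ℝ} (hr : 0 ≤ r) (n : ℕ) :
    (messageCount r n : ℝ) ≤ 2 * Real.exp (n * r) := by
  have h1 := (Nat.ceil_lt_add_one (Real.exp_pos (n * r)).le).le
  have h2 : (1 : ℝ) ≤ Real.exp (n * r) := Real.one_le_exp (by positivity)
  rw [messageCount]
  linarith

theorem messageCount_zero (n : ℕ) : messageCount 0 n = 1 := by simp [messageCount]

theorem tendsto_log_messageCount_div {r : ℝ} (hr : 0 ≤ r) :
    Tendsto (fun n : ℕ => Real.log (messageCount r n) / n) atTop (𝓝 r) := by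
  have hlim : Tendsto (fun n : ℕ => Real.log 2 / n + r) atTop (𝓝 r) := by
    simpa using (tendsto_const_div_atTop_nhds_zero_nat (Real.log 2)).add_const r
  refine tendsto_of_tendsto_of_tendsto_of_le_of_le' tendsto_const_nhds hlim ?_ ?_
  · filter_upwards [eventually_gt_atTop 0] with n hn
    have hn' : (0 : ℝ) < n := by exact_mod_cast hn
    rw [le_div_iff₀ hn', Real.le_log_iff_exp_le (by exact_mod_cast messageCount_pos r n), mul_comm]
    exact exp_le_messageCount r n
  · filter_upwards [eventually_gt_atTop 0] with n hn
    have hn' : (0 : ℝ) < n := by exact_mod_cast hn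
    have h1 := Real.log_le_log (by exact_mod_cast messageCount_pos r n) (messageCount_le hr n)
    rw [Real.log_mul two_ne_zero (Real.exp_pos _).ne', Real.log_exp] at h1
    rw [div_le_iff₀ hn', add_mul, div_mul_cancel₀ _ hn'.ne']
    linarith

end Asymptotics

/-! ### Conversion between types of encoders and decoders. -/

section Conversion

/-- The chain rule: the last symbol is drawn from its conditional law given the others, and
induction handles the prefix. It turns a nonadaptive encoder into an adaptive one that ignores the
outputs. -/
theorem exists_prod_kernel_eq {X : Type*} [Fintype X] [Nonempty X] (n : ℕ)
    (p : stdSimplex ℝ (Fin n → X)) :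
    ∃ K : (t : ℕ) → (Fin t → X) → stdSimplex ℝ X,
      ∀ x, p x = ∏ t : Fin n, K t (past x t) (x t) := by
  classical
  induction n with
  | zero =>
    refine ⟨fun _ _ => stdSimplex.vertex (Classical.arbitrary X), fun x => ?_⟩
    simp
  | succ n ih =>
    let p' : stdSimplex ℝ (Fin n → X) := stdSimplex.map Fin.init p
    obtain ⟨K', hK'⟩ := ih p'
    have hp' : ∀ q, p' q = ∑ a, p (Fin.snoc (α := fun _ => X) q a) := by
      intro q
      rw [map_apply_eq_sum,
        ← (Fin.snocEquiv (fun _ : Fin (n + 1) => X)).sum_comp, Fintype.sum_prod_type]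
      refine Finset.sum_congr rfl fun a _ => ?_
      rw [Finset.sum_eq_single q]
      · simp [Fin.snocEquiv]
      · intro r _ hr
        simp [Fin.snocEquiv, hr]
      · simp
    have hle : ∀ q a, p (Fin.snoc (α := fun _ => X) q a) ≤ p' q := by
      intro q a
      rw [hp']
      exact Finset.single_le_sum (f := fun a => p (Fin.snoc (α := fun _ => X) q a))
        (fun _ _ => stdSimplex.zero_le _ _) (Finset.mem_univ a)
    let Kn : (Fin n → X) → stdSimplex ℝ X := fun q =>
      -- Any law serves after a prefix of probability zero, since `p` vanishes on all its
      -- extensions.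
      if h : p' q = 0 then stdSimplex.vertex (Classical.arbitrary X)
      else ⟨fun a => p (Fin.snoc (α := fun _ => X) q a) / p' q,
        fun a => div_nonneg (stdSimplex.zero_le _ _) (stdSimplex.zero_le _ _), by
          rw [← Finset.sum_div, ← hp', div_self h]⟩
    have hKn : ∀ q a, p (Fin.snoc (α := fun _ => X) q a) = p' q * Kn q a := by
      intro q a
      by_cases h : p' q = 0
      · rw [h, zero_mul]
        exact le_antisymm (h ▸ hle q a) (stdSimplex.zero_le _ _)
      · have : Kn q a = p (Fin.snoc (α := fun _ => X) q a) / p' q := by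
          simp only [Kn, dif_neg h]
          rfl
        rw [this, mul_div_cancel₀ _ h]
    refine ⟨fun t q => if h : t = n then Kn (fun i => q (Fin.cast h.symm i)) else K' t q,
      fun x => ?_⟩
    rw [Fin.prod_univ_castSucc]
    have h1 : p x = p' (Fin.init x) * Kn (Fin.init x) (x (Fin.last n)) := by
      rw [← hKn, Fin.snoc_init_self]
    rw [h1, hK']
    congr 1
    · refine Finset.prod_congr rfl fun t _ => ?_
      beta_reduce
      rw [dif_neg (show ((t.castSucc : Fin (n + 1)) : ℕ) ≠ n from t.isLt.ne)]
      rfl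
    · beta_reduce
      rw [dif_pos (show ((Fin.last n : Fin (n + 1)) : ℕ) = n from rfl)]
      rfl

variable {X Y : Type*} [Fintype X] {n L : ℕ}

theorem Encoder.exists_of_nonadaptive [Nonempty X]
    (e : Encoder X Y n L EncoderType.nonadaptive) (c : EncoderType) :
    ∃ e' : Encoder X Y n L c, e'.prob = e.prob := by
  cases c with
  | nonadaptive => exact ⟨e, rfl⟩
  | adaptive =>
    cases e with
    | nonadaptive φ =>
      choose K hK using fun m => exists_prod_kernel_eq n (φ m)
      exact ⟨.adaptive fun t m x _ => K m t x, funext fun m => funext fun x => funext fun y =>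
        (hK m x).symm⟩

theorem Encoder.exists_adaptive [Nonempty X] {c : EncoderType} (e : Encoder X Y n L c) :
    ∃ e' : Encoder X Y n L EncoderType.adaptive, e'.prob = e.prob := by
  cases c with
  | adaptive => exact ⟨e, rfl⟩
  | nonadaptive => exact e.exists_of_nonadaptive _

theorem Decoder.exists_of_second {X Y : Type*} {n L L' : ℕ} (D : Decoder X Y n L L' DecoderType.second) (d : DecoderType) :
    ∃ D' : Decoder X Y n L L' d, D'.decode = D.decode := by
  cases d with
  | second => exact ⟨D, rfl⟩
  | first =>
    cases D with
    | second ψ => exact ⟨.first fun _ => ψ, rfl⟩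

variable {X₁ X₂ Y₁ Y₂ Z : Type*} [Fintype X₁] [Fintype X₂] [Fintype Y₁] [Fintype Y₂] [Fintype Z]
  [Nonempty X₁] [Nonempty X₂]

theorem Code.exists_of_nonadaptive_second
    (C : Code X₁ X₂ Y₁ Y₂ EncoderType.nonadaptive DecoderType.second n)
    (W : Channel X₁ X₂ Y₁ Y₂ Z) (c : EncoderType) (d : DecoderType) :
    ∃ C' : Code X₁ X₂ Y₁ Y₂ c d n, C'.rate₁ = C.rate₁ ∧ C'.rate₂ = C.rate₂ ∧
      C'.errorProb W = C.errorProb W ∧ C'.leakage₁ W = C.leakage₁ W ∧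
      C'.leakage₂ W = C.leakage₂ W := by
  obtain ⟨e₁, he₁⟩ := C.enc₁.exists_of_nonadaptive c
  obtain ⟨e₂, he₂⟩ := C.enc₂.exists_of_nonadaptive c
  obtain ⟨D₁, hD₁⟩ := C.dec₁.exists_of_second d
  obtain ⟨D₂, hD₂⟩ := C.dec₂.exists_of_second d
  have hT : ∀ m₁ m₂, traceLaw W e₁ e₂ m₁ m₂ = traceLaw W C.enc₁ C.enc₂ m₁ m₂ := by
    intro m₁ m₂
    apply Subtype.ext
    funext a
    simp only [traceLaw, traceProb, he₁, he₂]
  let C' : Code X₁ X₂ Y₁ Y₂ c d n := ⟨C.L₁, C.L₂, C.L₁_pos, C.L₂_pos, e₁, e₂, D₁, D₂⟩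
  have hlaw : C'.law W = C.law W := by
    apply Subtype.ext
    funext ω
    simp only [Code.law, C', hT]
  refine ⟨C', rfl, rfl, ?_, ?_, ?_⟩
  · simp only [Code.errorProb, C', hT, hD₁, hD₂]
  · exact congrArg (fun l => mutualInfo (stdSimplex.map _ l)) hlaw
  · exact congrArg (fun l => mutualInfo (stdSimplex.map _ l)) hlaw

end Conversion

/-! ### The additive channel in terms of inputs and noise. -/

section AdditiveChannel

variable {F : Type*} [Field F] [Fintype F] (a₁ b₁ a₂ b₂ a₃ b₃ : F) {n : ℕ}

theorem additiveChannel_apply (N : stdSimplex ℝ (F × F × F)) (x₁ x₂ y₁ y₂ z : F) :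
    additiveChannel a₁ b₁ a₂ b₂ a₃ b₃ N x₁ x₂ (y₁, y₂, z)
      = N (y₁ - (a₁ * x₁ + b₁ * x₂), y₂ - (a₂ * x₁ + b₂ * x₂), z - (a₃ * x₁ + b₃ * x₂)) := by
  classical
  rw [additiveChannel, map_apply_eq_sum, Finset.sum_eq_single
    (y₁ - (a₁ * x₁ + b₁ * x₂), y₂ - (a₂ * x₁ + b₂ * x₂), z - (a₃ * x₁ + b₃ * x₂))]
  · simp
  · rintro ⟨ν₁, ν₂, ν₃⟩ _ h
    rw [if_neg, mul_zero]
    intro h'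
    simp only [Prod.mk.injEq] at h'
    obtain ⟨rfl, rfl, rfl⟩ := h'
    simp at h
  · simp

/-- The trace with inputs `x₁`, `x₂` and noise `w`. -/
def additiveTrace (x₁ x₂ : Fin n → F) (w : Fin n → F × F × F) : Trace F F F F F n := fun t =>
  (x₁ t, x₂ t, a₁ * x₁ t + b₁ * x₂ t + (w t).1, a₂ * x₁ t + b₂ * x₂ t + (w t).2.1,
    a₃ * x₁ t + b₃ * x₂ t + (w t).2.2)

/-- A trace is determined by the inputs and the noise. -/
def additiveTraceEquiv :
    (Fin n → F) × (Fin n → F) × (Fin n → F × F × F) ≃ Trace F F F F F n where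
  toFun p := additiveTrace a₁ b₁ a₂ b₂ a₃ b₃ p.1 p.2.1 p.2.2
  invFun a := (a.x₁, a.x₂, fun t => (a.y₁ t - (a₁ * a.x₁ t + b₁ * a.x₂ t),
    a.y₂ t - (a₂ * a.x₁ t + b₂ * a.x₂ t), a.z t - (a₃ * a.x₁ t + b₃ * a.x₂ t)))
  left_inv p := by
    refine Prod.ext rfl (Prod.ext rfl (funext fun t => ?_))
    simp [additiveTrace, Trace.x₁, Trace.x₂, Trace.y₁, Trace.y₂, Trace.z]
  right_inv a := by
    funext t
    simp [additiveTrace, Trace.x₁, Trace.x₂, Trace.y₁, Trace.y₂, Trace.z]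

/-- Without adaptation the inputs and the noise are independent, and the trace is a bijective
function of them. -/
theorem sum_traceLaw_mul (N : stdSimplex ℝ (F × F × F)) {L₁ L₂ : ℕ}
    (φ₁ : Fin L₁ → stdSimplex ℝ (Fin n → F)) (φ₂ : Fin L₂ → stdSimplex ℝ (Fin n → F))
    (m₁ : Fin L₁) (m₂ : Fin L₂) (h : Trace F F F F F n → ℝ) :
    ∑ a, traceLaw (additiveChannel a₁ b₁ a₂ b₂ a₃ b₃ N) (.nonadaptive φ₁) (.nonadaptive φ₂)
        m₁ m₂ a * h a
      = ∑ x₁, φ₁ m₁ x₁ * ∑ x₂, φ₂ m₂ x₂ * ∑ w, iid N n w *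
          h (additiveTrace a₁ b₁ a₂ b₂ a₃ b₃ x₁ x₂ w) := by
  rw [← (additiveTraceEquiv a₁ b₁ a₂ b₂ a₃ b₃).sum_comp, Fintype.sum_prod_type]
  refine Finset.sum_congr rfl fun x₁ _ => ?_
  rw [Fintype.sum_prod_type, Finset.mul_sum]
  refine Finset.sum_congr rfl fun x₂ _ => ?_
  rw [Finset.mul_sum, Finset.mul_sum]
  refine Finset.sum_congr rfl fun w _ => ?_
  have h1 : traceLaw (additiveChannel a₁ b₁ a₂ b₂ a₃ b₃ N) (.nonadaptive φ₁) (.nonadaptive φ₂)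
      m₁ m₂ (additiveTrace a₁ b₁ a₂ b₂ a₃ b₃ x₁ x₂ w)
      = φ₁ m₁ x₁ * φ₂ m₂ x₂ * iid N n w := by
    change traceProb _ _ _ _ _ _ = _
    simp only [traceProb, additiveChannel_apply]
    simp only [Encoder.prob, iid_apply]
    congr 1
    exact Finset.prod_congr rfl fun t _ => by
      simp [additiveTrace, Trace.x₁, Trace.x₂, Trace.y₁, Trace.y₂, Trace.z]
  change traceLaw _ _ _ _ _ (additiveTrace a₁ b₁ a₂ b₂ a₃ b₃ x₁ x₂ w) *
    h (additiveTrace a₁ b₁ a₂ b₂ a₃ b₃ x₁ x₂ w) = _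
  rw [h1]
  ring

end AdditiveChannel

/-! ### Leakage bounded by the divergence of the conditional outputs from uniform. -/

section Leakage

variable {X₁ X₂ Y₁ Y₂ Z : Type*} [Fintype X₁] [Fintype X₂] [Fintype Y₁] [Fintype Y₂] [Fintype Z]
  {c : EncoderType} {d : DecoderType} {n : ℕ}

open Classical in
theorem Code.leakage₁_le (C : Code X₁ X₂ Y₁ Y₂ c d n) (W : Channel X₁ X₂ Y₁ Y₂ Z)
    (Q : Fin C.L₁ → stdSimplex ℝ (Fin n → Z))
    (hQ : ∀ m₁ z, Q m₁ z = (C.L₂ : ℝ)⁻¹ * ∑ m₂, ∑ a, traceLaw W C.enc₁ C.enc₂ m₁ m₂ a *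
      (if a.z = z then 1 else 0)) :
    C.leakage₁ W ≤ (C.L₁ : ℝ)⁻¹ * ∑ m₁, divUniform (Q m₁) := by
  have : Nonempty (Fin C.L₁) := ⟨⟨0, C.L₁_pos⟩⟩
  refine (mutualInfo_le_of_uniform Q fun m z => ?_).trans (by simp)
  rw [map_apply_eq_sum, Fintype.sum_prod_type, Finset.sum_eq_single m]
  · rw [Fintype.sum_prod_type, hQ, Fintype.card_fin, ← mul_assoc, Finset.mul_sum]
    refine Finset.sum_congr rfl fun m₂ _ => ?_
    rw [Finset.mul_sum]
    refine Finset.sum_congr rfl fun a _ => ?_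
    rw [← mul_assoc]
    simp only [Prod.mk.injEq, true_and]
    rfl
  · intro m' _ hm
    simp [hm]
  · simp

open Classical in
theorem Code.leakage₂_le (C : Code X₁ X₂ Y₁ Y₂ c d n) (W : Channel X₁ X₂ Y₁ Y₂ Z)
    (Q : Fin C.L₂ → stdSimplex ℝ (Fin n → Z))
    (hQ : ∀ m₂ z, Q m₂ z = (C.L₁ : ℝ)⁻¹ * ∑ m₁, ∑ a, traceLaw W C.enc₁ C.enc₂ m₁ m₂ a *
      (if a.z = z then 1 else 0)) :
    C.leakage₂ W ≤ (C.L₂ : ℝ)⁻¹ * ∑ m₂, divUniform (Q m₂) := by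
  have : Nonempty (Fin C.L₂) := ⟨⟨0, C.L₂_pos⟩⟩
  refine (mutualInfo_le_of_uniform Q fun m z => ?_).trans (by simp)
  rw [map_apply_eq_sum, Fintype.sum_prod_type, hQ, Fintype.card_fin, ← mul_assoc, Finset.mul_sum]
  refine Finset.sum_congr rfl fun m₁ _ => ?_
  rw [Fintype.sum_prod_type, Finset.sum_eq_single m]
  · rw [Finset.mul_sum]
    refine Finset.sum_congr rfl fun a _ => ?_
    rw [← mul_assoc, mul_comm (C.L₂ : ℝ)⁻¹]
    simp only [Prod.mk.injEq, true_and]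
    rfl
  · intro m' _ hm
    simp [hm]
  · simp

end Leakage

/-! ### Marginals of the noise block and dithered encoders. -/

section Noise

variable {F : Type*} [Fintype F] (N : stdSimplex ℝ (F × F × F)) {n : ℕ}

theorem sum_iid_noise₁ (g : (Fin n → F) → ℝ) :
    ∑ w, iid N n w * g (fun t => (w t).1) = ∑ v, iid (noise₁ N) n v * g v := by
  rw [noise₁, ← map_iid, sum_map_mul]

theorem sum_iid_noise₂ (g : (Fin n → F) → ℝ) :
    ∑ w, iid N n w * g (fun t => (w t).2.1) = ∑ v, iid (noise₂ N) n v * g v := by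
  rw [noise₂, ← map_iid, sum_map_mul]

theorem sum_iid_noise₃ (g : (Fin n → F) → ℝ) :
    ∑ w, iid N n w * g (fun t => (w t).2.2) = ∑ v, iid (noise₃ N) n v * g v := by
  rw [noise₃, ← map_iid, sum_map_mul]

theorem inv_mul_sum_const {D : ℕ} [NeZero D] (x : ℝ) : (D : ℝ)⁻¹ * ∑ _d : Fin D, x = x := by
  have hD : (D : ℝ) ≠ 0 := NeZero.ne _
  simp [hD]

theorem inv_card_mul_sum_prod {A B C : ℕ} (f : Fin A → Fin B → Fin C → ℝ) :
    (Fintype.card (Fin A × Fin B × Fin C) : ℝ)⁻¹ * ∑ u : Fin A × Fin B × Fin C, f u.1 u.2.1 u.2.2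
      = (A : ℝ)⁻¹ * ∑ a, (B : ℝ)⁻¹ * ∑ b, (C : ℝ)⁻¹ * ∑ c, f a b c := by
  simp_rw [Fintype.sum_prod_type, ← Finset.mul_sum]
  simp
  ring

/-- The encoder that sends the code word of the message and of a uniform dither. -/
def ditherEncoder {L D : ℕ} [NeZero D] (x : Fin L × Fin D → Fin n → F) (m : Fin L) :
    stdSimplex ℝ (Fin n → F) :=
  stdSimplex.map (fun d => x (m, d)) (stdSimplex.barycenter : stdSimplex ℝ (Fin D))

theorem sum_ditherEncoder_mul {L D : ℕ} [NeZero D] (x : Fin L × Fin D → Fin n → F) (m : Fin L)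
    (g : (Fin n → F) → ℝ) :
    ∑ v, ditherEncoder x m v * g v = (D : ℝ)⁻¹ * ∑ d, g (x (m, d)) := by
  have h : ∀ d : Fin D, (stdSimplex.barycenter : stdSimplex ℝ (Fin D)) d = (D : ℝ)⁻¹ := by
    intro d
    exact (stdSimplex.barycenter_apply d).trans (by simp)
  rw [ditherEncoder, sum_map_mul, Finset.mul_sum]
  simp_rw [h]

end Noise

/-! ### Error probability and leakage of the code given by two codebooks. -/

section CodebookCode

variable {F : Type*} [Field F] [Fintype F] (a₁ b₁ a₂ b₂ a₃ b₃ : F) (N : stdSimplex ℝ (F × F × F))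
  {n L₁ D₁ L₂ D₂ : ℕ} [NeZero D₁] [NeZero D₂]

variable (x₁ : Fin L₁ × Fin D₁ → Fin n → F) (x₂ : Fin L₂ × Fin D₂ → Fin n → F)

theorem sum_traceLaw_codebookCode_mul (m₁ : Fin L₁) (m₂ : Fin L₂)
    (h : Trace F F F F F n → ℝ) :
    ∑ a, traceLaw (additiveChannel a₁ b₁ a₂ b₂ a₃ b₃ N) (.nonadaptive (ditherEncoder x₁))
        (.nonadaptive (ditherEncoder x₂)) m₁ m₂ a * h a
      = (D₁ : ℝ)⁻¹ * ∑ d₁, (D₂ : ℝ)⁻¹ * ∑ d₂, ∑ w, iid N n w *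
          h (additiveTrace a₁ b₁ a₂ b₂ a₃ b₃ (x₁ (m₁, d₁)) (x₂ (m₂, d₂)) w) := by
  rw [sum_traceLaw_mul]
  simp_rw [sum_ditherEncoder_mul]

open Classical in
theorem sum_traceLaw_codebookCode_z (m₁ : Fin L₁) (m₂ : Fin L₂) (z : Fin n → F) :
    ∑ a, traceLaw (additiveChannel a₁ b₁ a₂ b₂ a₃ b₃ N) (.nonadaptive (ditherEncoder x₁))
        (.nonadaptive (ditherEncoder x₂)) m₁ m₂ a * (if a.z = z then 1 else 0)
      = (D₁ : ℝ)⁻¹ * ∑ d₁, (D₂ : ℝ)⁻¹ * ∑ d₂,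
          iid (noise₃ N) n (z - (a₃ • x₁ (m₁, d₁) + b₃ • x₂ (m₂, d₂))) := by
  rw [sum_traceLaw_codebookCode_mul]
  congr 1
  refine Finset.sum_congr rfl fun d₁ _ => ?_
  congr 1
  refine Finset.sum_congr rfl fun d₂ _ => ?_
  have h4 : ∀ w, (additiveTrace a₁ b₁ a₂ b₂ a₃ b₃ (x₁ (m₁, d₁)) (x₂ (m₂, d₂)) w).z
      = a₃ • x₁ (m₁, d₁) + b₃ • x₂ (m₂, d₂) + fun t => (w t).2.2 := fun w => rfl
  simp_rw [h4]
  rw [sum_iid_noise₃ N fun v =>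
    if a₃ • x₁ (m₁, d₁) + b₃ • x₂ (m₂, d₂) + v = z then (1 : ℝ) else 0]
  simp_rw [← eq_sub_iff_add_eq']
  simp

variable [NeZero L₁] [NeZero L₂]

/-- The code with dithered encoders and maximum likelihood decoders that is given by two
codebooks. -/
def codebookCode :
    Code F F F F EncoderType.nonadaptive DecoderType.second n where
  L₁ := L₁
  L₂ := L₂
  L₁_pos := Nat.pos_of_neZero L₁
  L₂_pos := Nat.pos_of_neZero L₂
  enc₁ := .nonadaptive (ditherEncoder x₁)
  enc₂ := .nonadaptive (ditherEncoder x₂)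
  dec₁ := .second fun x y =>
    (mlDecode (fun u => b₁ • x₂ u) (iid (noise₁ N) n) (y - a₁ • x)).1
  dec₂ := .second fun x y =>
    (mlDecode (fun u => a₂ • x₁ u) (iid (noise₂ N) n) (y - b₂ • x)).1

open Classical in
-- The decoder estimates message and dither together; a wrong message means a wrong pair.
theorem sum_decode_fst_ne_le {L D : ℕ} [NeZero L] [NeZero D] (x : Fin L × Fin D → Fin n → F)
    (P : stdSimplex ℝ (Fin n → F)) :
    (L : ℝ)⁻¹ * ∑ m, (D : ℝ)⁻¹ * ∑ d, ∑ v, P v *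
        (if (mlDecode x P (x (m, d) + v)).1 ≠ m then (1 : ℝ) else 0) ≤ mlError x P := by
  rw [mlError, Fintype.sum_prod_type, ← Finset.mul_sum, ← mul_assoc, Fintype.card_prod,
    Fintype.card_fin, Fintype.card_fin, Nat.cast_mul, mul_inv]
  gcongr with m _ d _ v _
  · exact stdSimplex.zero_le _ _
  · by_cases h : mlDecode x P (x (m, d) + v) = (m, d)
    · simp [h]
    · rw [if_pos h]
      split_ifs <;> simp

/-- A union bound over the two users. Subtracting its own input leaves each user a point-to-point
channel that involves one noise marginal only, so the joint law of the noises is irrelevant. -/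
theorem errorProb_codebookCode_le :
    (codebookCode a₁ b₁ a₂ b₂ N x₁ x₂).errorProb (additiveChannel a₁ b₁ a₂ b₂ a₃ b₃ N)
      ≤ mlError (fun u => b₁ • x₂ u) (iid (noise₁ N) n)
        + mlError (fun u => a₂ • x₁ u) (iid (noise₂ N) n) := by
  classical
  let T := traceLaw (additiveChannel a₁ b₁ a₂ b₂ a₃ b₃ N)
    (.nonadaptive (ditherEncoder x₁) : Encoder F F n L₁ _) (.nonadaptive (ditherEncoder x₂))
  let err₁ : Fin L₂ → Trace F F F F F n → ℝ := fun m₂ a =>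
    if (mlDecode (fun u => b₁ • x₂ u) (iid (noise₁ N) n) (a.y₁ - a₁ • a.x₁)).1 ≠ m₂ then 1 else 0
  let err₂ : Fin L₁ → Trace F F F F F n → ℝ := fun m₁ a =>
    if (mlDecode (fun u => a₂ • x₁ u) (iid (noise₂ N) n) (a.y₂ - b₂ • a.x₂)).1 ≠ m₁ then 1 else 0
  have h1 : (codebookCode a₁ b₁ a₂ b₂ N x₁ x₂).errorProb (additiveChannel a₁ b₁ a₂ b₂ a₃ b₃ N)
      ≤ ((L₁ : ℝ) * L₂)⁻¹ * ∑ m₁, ∑ m₂, (∑ a, T m₁ m₂ a * err₁ m₂ a + ∑ a, T m₁ m₂ a * err₂ m₁ a) := by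
    refine mul_le_mul_of_nonneg_left (Finset.sum_le_sum fun m₁ _ => Finset.sum_le_sum fun m₂ _ => ?_)
      (by positivity)
    rw [Finset.sum_filter, ← Finset.sum_add_distrib]
    refine Finset.sum_le_sum fun a _ => ?_
    rw [← mul_add]
    have hT : 0 ≤ T m₁ m₂ a := stdSimplex.zero_le _ _
    have e₁ : 0 ≤ err₁ m₂ a := by simp only [err₁]; split_ifs <;> simp
    have e₂ : 0 ≤ err₂ m₁ a := by simp only [err₂]; split_ifs <;> simp
    split_ifs with h
    · refine le_mul_of_one_le_right hT ?_
      rcases h with h | h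
      · have : err₂ m₁ a = 1 := if_pos h
        linarith
      · have : err₁ m₂ a = 1 := if_pos h
        linarith
    · exact mul_nonneg hT (by linarith)
  refine h1.trans ?_
  simp_rw [Finset.sum_add_distrib, mul_add]
  refine add_le_add ((le_of_eq ?_).trans (sum_decode_fst_ne_le (fun u => b₁ • x₂ u) _))
    ((le_of_eq ?_).trans (sum_decode_fst_ne_le (fun u => a₂ • x₁ u) _))
  · have h2 : ∀ m₁ m₂, ∑ a, T m₁ m₂ a * err₁ m₂ a = (D₂ : ℝ)⁻¹ * ∑ d₂, ∑ v, iid (noise₁ N) n v *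
        (if (mlDecode (fun u => b₁ • x₂ u) (iid (noise₁ N) n) (b₁ • x₂ (m₂, d₂) + v)).1 ≠ m₂
          then (1 : ℝ) else 0) := by
      intro m₁ m₂
      rw [sum_traceLaw_codebookCode_mul]
      have h3 : ∀ d₁ d₂, ∑ w, iid N n w *
          err₁ m₂ (additiveTrace a₁ b₁ a₂ b₂ a₃ b₃ (x₁ (m₁, d₁)) (x₂ (m₂, d₂)) w)
          = ∑ v, iid (noise₁ N) n v *
        (if (mlDecode (fun u => b₁ • x₂ u) (iid (noise₁ N) n) (b₁ • x₂ (m₂, d₂) + v)).1 ≠ m₂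
          then (1 : ℝ) else 0) := by
        intro d₁ d₂
        rw [← sum_iid_noise₁]
        refine Finset.sum_congr rfl fun w _ => ?_
        have h4 : (additiveTrace a₁ b₁ a₂ b₂ a₃ b₃ (x₁ (m₁, d₁)) (x₂ (m₂, d₂)) w).y₁ - a₁ •
            (additiveTrace a₁ b₁ a₂ b₂ a₃ b₃ (x₁ (m₁, d₁)) (x₂ (m₂, d₂)) w).x₁
            = b₁ • x₂ (m₂, d₂) + fun t => (w t).1 := by
          funext t
          simp [additiveTrace, Trace.y₁, Trace.x₁]
          ring
        simp only [err₁, h4]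
      simp_rw [h3, inv_mul_sum_const]
    simp_rw [h2]
    rw [mul_inv, mul_comm (L₁ : ℝ)⁻¹, mul_assoc, inv_mul_sum_const]
  · have h2 : ∀ m₁ m₂, ∑ a, T m₁ m₂ a * err₂ m₁ a = (D₁ : ℝ)⁻¹ * ∑ d₁, ∑ v, iid (noise₂ N) n v *
        (if (mlDecode (fun u => a₂ • x₁ u) (iid (noise₂ N) n) (a₂ • x₁ (m₁, d₁) + v)).1 ≠ m₁
          then (1 : ℝ) else 0) := by
      intro m₁ m₂
      rw [sum_traceLaw_codebookCode_mul]
      have h3 : ∀ d₁ d₂, ∑ w, iid N n w *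
          err₂ m₁ (additiveTrace a₁ b₁ a₂ b₂ a₃ b₃ (x₁ (m₁, d₁)) (x₂ (m₂, d₂)) w)
          = ∑ v, iid (noise₂ N) n v *
        (if (mlDecode (fun u => a₂ • x₁ u) (iid (noise₂ N) n) (a₂ • x₁ (m₁, d₁) + v)).1 ≠ m₁
          then (1 : ℝ) else 0) := by
        intro d₁ d₂
        rw [← sum_iid_noise₂]
        refine Finset.sum_congr rfl fun w _ => ?_
        have h4 : (additiveTrace a₁ b₁ a₂ b₂ a₃ b₃ (x₁ (m₁, d₁)) (x₂ (m₂, d₂)) w).y₂ - b₂ •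
            (additiveTrace a₁ b₁ a₂ b₂ a₃ b₃ (x₁ (m₁, d₁)) (x₂ (m₂, d₂)) w).x₂
            = a₂ • x₁ (m₁, d₁) + fun t => (w t).2.1 := by
          funext t
          simp [additiveTrace, Trace.y₂, Trace.x₂]
          ring
        simp only [err₂, h4]
      simp_rw [h3, inv_mul_sum_const]
    simp_rw [h2]
    rw [mul_inv, mul_assoc, Finset.mul_sum]
    simp_rw [inv_mul_sum_const]

/-- Given `m₁`, the other message and both dithers are uniform and act together as the index of one
noisy code. -/
theorem leakage₁_codebookCode_le :
    (codebookCode a₁ b₁ a₂ b₂ N x₁ x₂).leakage₁ (additiveChannel a₁ b₁ a₂ b₂ a₃ b₃ N)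
      ≤ (L₁ : ℝ)⁻¹ * ∑ m₁, divUniform (noisyLaw
          (fun u : Fin L₂ × Fin D₁ × Fin D₂ => a₃ • x₁ (m₁, u.2.1) + b₃ • x₂ (u.1, u.2.2))
          (iid (noise₃ N) n)) := by
  classical
  refine Code.leakage₁_le (codebookCode a₁ b₁ a₂ b₂ N x₁ x₂) _ (fun m₁ : Fin L₁ => noisyLaw
    (fun u : Fin L₂ × Fin D₁ × Fin D₂ => a₃ • x₁ (m₁, u.2.1) + b₃ • x₂ (u.1, u.2.2))
    (iid (noise₃ N) n)) fun m z => ?_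
  refine Eq.trans ?_ (congrArg (fun s => (L₂ : ℝ)⁻¹ * s) (Finset.sum_congr rfl fun m₂ _ =>
    sum_traceLaw_codebookCode_z a₁ b₁ a₂ b₂ a₃ b₃ N x₁ x₂ m m₂ z)).symm
  exact inv_card_mul_sum_prod fun (i : Fin L₂) d₁ d₂ =>
    iid (noise₃ N) n (z - (a₃ • x₁ (m, d₁) + b₃ • x₂ (i, d₂)))

theorem leakage₂_codebookCode_le :
    (codebookCode a₁ b₁ a₂ b₂ N x₁ x₂).leakage₂ (additiveChannel a₁ b₁ a₂ b₂ a₃ b₃ N)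
      ≤ (L₂ : ℝ)⁻¹ * ∑ m₂, divUniform (noisyLaw
          (fun u : Fin L₁ × Fin D₁ × Fin D₂ => a₃ • x₁ (u.1, u.2.1) + b₃ • x₂ (m₂, u.2.2))
          (iid (noise₃ N) n)) := by
  classical
  refine Code.leakage₂_le (codebookCode a₁ b₁ a₂ b₂ N x₁ x₂) _ (fun m₂ : Fin L₂ => noisyLaw
    (fun u : Fin L₁ × Fin D₁ × Fin D₂ => a₃ • x₁ (u.1, u.2.1) + b₃ • x₂ (m₂, u.2.2))
    (iid (noise₃ N) n)) fun m z => ?_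
  refine Eq.trans ?_ (congrArg (fun s => (L₁ : ℝ)⁻¹ * s) (Finset.sum_congr rfl fun m₁ _ =>
    sum_traceLaw_codebookCode_z a₁ b₁ a₂ b₂ a₃ b₃ N x₁ x₂ m₁ m z)).symm
  exact inv_card_mul_sum_prod fun (i : Fin L₁) d₁ d₂ =>
    iid (noise₃ N) n (z - (a₃ • x₁ (i, d₁) + b₃ • x₂ (m, d₂)))

end CodebookCode

/-! ### The resolvability bound, with uniform noise treated separately. -/

section Bounds

variable {V : Type*} [Fintype V]

open Classical in
/-- The random coding bound on the divergence from the uniform distribution at the output of a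
code with `K` words. -/
def resolvabilityBound (P : stdSimplex ℝ V) (K : ℕ) : ℝ :=
  if ∀ v, P v = (Fintype.card V : ℝ)⁻¹ then 0
  else ∑ v, P v * Real.log (1 + Fintype.card V * P v / K)

theorem sum_mul_log_one_add_nonneg (P : stdSimplex ℝ V) (K : ℕ) :
    0 ≤ ∑ v, P v * Real.log (1 + Fintype.card V * P v / K) :=
  Finset.sum_nonneg fun v _ => mul_nonneg (stdSimplex.zero_le _ _) <| Real.log_nonneg <|
    le_add_of_nonneg_right <| div_nonneg (mul_nonneg (by positivity) (stdSimplex.zero_le _ _))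
      (by positivity)

theorem resolvabilityBound_nonneg (P : stdSimplex ℝ V) (K : ℕ) : 0 ≤ resolvabilityBound P K := by
  rw [resolvabilityBound]
  split_ifs
  · exact le_rfl
  · exact sum_mul_log_one_add_nonneg P K

theorem mlBound_one (P : stdSimplex ℝ V) : mlBound P 1 = 0 := by
  simp [mlBound]

theorem UniformDifferences.sum_divUniform_le_resolvabilityBound {G κ : Type*} [Fintype G]
    [Fintype κ] [Nonempty κ] [AddCommGroup V] {x : G → κ → V} (hx : UniformDifferences x)
    (N : stdSimplex ℝ V) :
    ∑ g, divUniform (noisyLaw (x g) N)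
      ≤ Fintype.card G * resolvabilityBound N (Fintype.card κ) := by
  rw [resolvabilityBound]
  split_ifs with h
  · simp [divUniform_noisyLaw_eq_zero _ N h]
  · exact hx.sum_divUniform_le N

/-- Zero capacity forces uniform noise, where the output is exactly uniform. The case split in
`resolvabilityBound` is for this: the rates may all be zero, and the logarithmic sum need not vanish
then. -/
theorem tendsto_resolvabilityBound_of_capacity_eq_zero {F : Type*} [Fintype F]
    (P : stdSimplex ℝ F) (hP : capacity P = 0) (K : ℕ → ℕ) :
    Tendsto (fun n => resolvabilityBound (iid P n) (K n)) atTop (𝓝 0) := by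
  have h : ∀ n, resolvabilityBound (iid P n) (K n) = 0 := by
    intro n
    refine if_pos fun v => ?_
    rw [iid_apply]
    simp_rw [eq_inv_card_of_log_card_le_entropy P (sub_eq_zero.1 hP).le]
    simp
  simp [h]

theorem tendsto_resolvabilityBound_of_lt {F : Type*} [Fintype F]
    (P : stdSimplex ℝ F) {K : ℕ → ℕ} {ρ : ℝ} (hK : ∀ n : ℕ, Real.exp (n * ρ) ≤ K n)
    (hρ : capacity P < ρ) :
    Tendsto (fun n => resolvabilityBound (iid P n) (K n)) atTop (𝓝 0) := by
  refine squeeze_zero (fun n => resolvabilityBound_nonneg _ _) (fun n => ?_)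
    (tendsto_resolvabilityBound P hK hρ)
  rw [resolvabilityBound]
  split_ifs
  · exact sum_mul_log_one_add_nonneg _ _
  · exact le_rfl

end Bounds

/-! ### Existence of one good pair of codebooks. -/

section Codebooks

variable {F ι₁ ι₂ κ : Type*} [Field F] [Fintype F] [Fintype ι₁] [Fintype ι₂] {n : ℕ}

theorem uniformDifferences_smul_fst [DecidableEq ι₁] [DecidableEq ι₂] {a : F} (ha : a ≠ 0) :
    UniformDifferences fun (g : (ι₁ → Fin n → F) × (ι₂ → Fin n → F)) u => a • g.1 u := by
  refine UniformDifferences.of_shift fun i j hij w =>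
    ⟨Equiv.addRight (Pi.single i (a⁻¹ • w), 0), fun g => ?_⟩
  simp [Pi.single_eq_of_ne hij.symm, smul_smul, ha]
  abel

theorem uniformDifferences_smul_snd [DecidableEq ι₁] [DecidableEq ι₂] {a : F} (ha : a ≠ 0) :
    UniformDifferences fun (g : (ι₁ → Fin n → F) × (ι₂ → Fin n → F)) u => a • g.2 u := by
  refine UniformDifferences.of_shift fun i j hij w =>
    ⟨Equiv.addRight (0, Pi.single i (a⁻¹ • w)), fun g => ?_⟩
  simp [Pi.single_eq_of_ne hij.symm, smul_smul, ha]
  abel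

/-- The sums of words are not mutually independent, but distinct indices differ in one of the two
codebooks, and translating that single word of index `i` leaves the word of index `j` unchanged. -/
theorem uniformDifferences_add [DecidableEq ι₁] [DecidableEq ι₂] {a b : F} (ha : a ≠ 0)
    (hb : b ≠ 0) {p : κ → ι₁} {r : κ → ι₂} (hpr : ∀ i j, p i = p j → r i = r j → i = j) :
    UniformDifferences fun (g : (ι₁ → Fin n → F) × (ι₂ → Fin n → F)) u =>
      a • g.1 (p u) + b • g.2 (r u) := by
  refine UniformDifferences.of_shift fun i j hij w => ?_
  by_cases hp : p i = p j
  · have hr : r j ≠ r i := fun h => hij (hpr i j hp h.symm)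
    refine ⟨Equiv.addRight (0, Pi.single (r i) (b⁻¹ • w)), fun g => ?_⟩
    simp [Pi.single_eq_of_ne hr, smul_smul, hb]
    abel
  · refine ⟨Equiv.addRight (Pi.single (p i) (a⁻¹ • w), 0), fun g => ?_⟩
    simp [Pi.single_eq_of_ne (Ne.symm hp), smul_smul, ha]
    abel

theorem exists_code_le (a₁ : F) {b₁ a₂ : F} (b₂ : F) {a₃ b₃ : F} (hb₁ : b₁ ≠ 0) (ha₂ : a₂ ≠ 0)
    (ha₃ : a₃ ≠ 0) (hb₃ : b₃ ≠ 0) (N : stdSimplex ℝ (F × F × F)) (n L₁ D₁ L₂ D₂ : ℕ)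
    [NeZero L₁] [NeZero D₁] [NeZero L₂] [NeZero D₂] {B : ℝ}
    (hB : mlBound (iid (noise₁ N) n) (L₂ * D₂) + mlBound (iid (noise₂ N) n) (L₁ * D₁)
      + resolvabilityBound (iid (noise₃ N) n) (L₂ * (D₁ * D₂))
      + resolvabilityBound (iid (noise₃ N) n) (L₁ * (D₁ * D₂)) ≤ B) :
    ∃ C : Code F F F F EncoderType.nonadaptive DecoderType.second n, C.L₁ = L₁ ∧ C.L₂ = L₂ ∧
      C.errorProb (additiveChannel a₁ b₁ a₂ b₂ a₃ b₃ N) ≤ B ∧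
      C.leakage₁ (additiveChannel a₁ b₁ a₂ b₂ a₃ b₃ N) ≤ B ∧
      C.leakage₂ (additiveChannel a₁ b₁ a₂ b₂ a₃ b₃ N) ≤ B := by
  classical
  let G := (Fin L₁ × Fin D₁ → Fin n → F) × (Fin L₂ × Fin D₂ → Fin n → F)
  let e₁ : G → ℝ := fun g => mlError (fun u => b₁ • g.2 u) (iid (noise₁ N) n)
  let e₂ : G → ℝ := fun g => mlError (fun u => a₂ • g.1 u) (iid (noise₂ N) n)
  let l₁ : G → ℝ := fun g => (L₁ : ℝ)⁻¹ * ∑ m₁, divUniform (noisyLaw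
    (fun u : Fin L₂ × Fin D₁ × Fin D₂ => a₃ • g.1 (m₁, u.2.1) + b₃ • g.2 (u.1, u.2.2))
    (iid (noise₃ N) n))
  let l₂ : G → ℝ := fun g => (L₂ : ℝ)⁻¹ * ∑ m₂, divUniform (noisyLaw
    (fun u : Fin L₁ × Fin D₁ × Fin D₂ => a₃ • g.1 (u.1, u.2.1) + b₃ • g.2 (m₂, u.2.2))
    (iid (noise₃ N) n))
  have he₁ : ∑ g, e₁ g ≤ Fintype.card G * mlBound (iid (noise₁ N) n) (L₂ * D₂) := by
    have h := (uniformDifferences_smul_snd (ι₁ := Fin L₁ × Fin D₁) (ι₂ := Fin L₂ × Fin D₂)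
      hb₁).sum_mlError_le (iid (noise₁ N) n)
    rwa [show Fintype.card (Fin L₂ × Fin D₂) = L₂ * D₂ by simp] at h
  have he₂ : ∑ g, e₂ g ≤ Fintype.card G * mlBound (iid (noise₂ N) n) (L₁ * D₁) := by
    have h := (uniformDifferences_smul_fst (ι₁ := Fin L₁ × Fin D₁) (ι₂ := Fin L₂ × Fin D₂)
      ha₂).sum_mlError_le (iid (noise₂ N) n)
    rwa [show Fintype.card (Fin L₁ × Fin D₁) = L₁ * D₁ by simp] at h
  have hl₁ : ∑ g, l₁ g
      ≤ Fintype.card G * resolvabilityBound (iid (noise₃ N) n) (L₂ * (D₁ * D₂)) := by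
    rw [← Finset.mul_sum, Finset.sum_comm]
    have h : ∀ m₁ : Fin L₁, ∑ g : G, divUniform (noisyLaw
        (fun u : Fin L₂ × Fin D₁ × Fin D₂ => a₃ • g.1 (m₁, u.2.1) + b₃ • g.2 (u.1, u.2.2))
        (iid (noise₃ N) n))
        ≤ Fintype.card G * resolvabilityBound (iid (noise₃ N) n) (L₂ * (D₁ * D₂)) := by
      intro m₁
      have hu := uniformDifferences_add (n := n) (κ := Fin L₂ × Fin D₁ × Fin D₂) ha₃ hb₃
        (p := fun u => (m₁, u.2.1)) (r := fun u => (u.1, u.2.2)) (by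
          rintro ⟨_, _, _⟩ ⟨_, _, _⟩ h h'
          simp_all)
      have h := hu.sum_divUniform_le_resolvabilityBound (iid (noise₃ N) n)
      rwa [show Fintype.card (Fin L₂ × Fin D₁ × Fin D₂) = L₂ * (D₁ * D₂) by simp] at h
    refine (mul_le_mul_of_nonneg_left (Finset.sum_le_sum fun m₁ _ => h m₁) (by positivity)).trans ?_
    rw [inv_mul_sum_const]
  have hl₂ : ∑ g, l₂ g
      ≤ Fintype.card G * resolvabilityBound (iid (noise₃ N) n) (L₁ * (D₁ * D₂)) := by
    rw [← Finset.mul_sum, Finset.sum_comm]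
    have h : ∀ m₂ : Fin L₂, ∑ g : G, divUniform (noisyLaw
        (fun u : Fin L₁ × Fin D₁ × Fin D₂ => a₃ • g.1 (u.1, u.2.1) + b₃ • g.2 (m₂, u.2.2))
        (iid (noise₃ N) n))
        ≤ Fintype.card G * resolvabilityBound (iid (noise₃ N) n) (L₁ * (D₁ * D₂)) := by
      intro m₂
      have hu := uniformDifferences_add (n := n) (κ := Fin L₁ × Fin D₁ × Fin D₂) ha₃ hb₃
        (p := fun u => (u.1, u.2.1)) (r := fun u => (m₂, u.2.2)) (by
          rintro ⟨_, _, _⟩ ⟨_, _, _⟩ h h'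
          simp_all)
      have h := hu.sum_divUniform_le_resolvabilityBound (iid (noise₃ N) n)
      rwa [show Fintype.card (Fin L₁ × Fin D₁ × Fin D₂) = L₁ * (D₁ * D₂) by simp] at h
    refine (mul_le_mul_of_nonneg_left (Finset.sum_le_sum fun m₂ _ => h m₂) (by positivity)).trans ?_
    rw [inv_mul_sum_const]
  -- The four costs are averaged together: some codebook pair has total at most `B`, and
  -- nonnegativity then bounds each cost by `B`.
  have hsum : ∑ g, (e₁ g + e₂ g + l₁ g + l₂ g) ≤ ∑ _g : G, B := by
    simp only [Finset.sum_add_distrib, Finset.sum_const, Finset.card_univ, nsmul_eq_mul]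
    refine le_trans ?_ (mul_le_mul_of_nonneg_left hB (by positivity))
    linarith
  obtain ⟨g, -, hg⟩ := Finset.exists_le_of_sum_le Finset.univ_nonempty hsum
  have he₁0 : 0 ≤ e₁ g := mlError_nonneg _ _
  have he₂0 : 0 ≤ e₂ g := mlError_nonneg _ _
  have hl₁0 : 0 ≤ l₁ g :=
    mul_nonneg (by positivity) (Finset.sum_nonneg fun _ _ => divUniform_nonneg _)
  have hl₂0 : 0 ≤ l₂ g :=
    mul_nonneg (by positivity) (Finset.sum_nonneg fun _ _ => divUniform_nonneg _)
  refine ⟨codebookCode a₁ b₁ a₂ b₂ N g.1 g.2, rfl, rfl, ?_, ?_, ?_⟩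
  · refine (errorProb_codebookCode_le a₁ b₁ a₂ b₂ a₃ b₃ N g.1 g.2).trans ?_
    change e₁ g + e₂ g ≤ B
    linarith
  · refine (leakage₁_codebookCode_le a₁ b₁ a₂ b₂ a₃ b₃ N g.1 g.2).trans ?_
    change l₁ g ≤ B
    linarith
  · refine (leakage₂_codebookCode_le a₁ b₁ a₂ b₂ a₃ b₃ N g.1 g.2).trans ?_
    change l₂ g ≤ B
    linarith

end Codebooks

/-! ### Choice of rates and the achievability half. -/

section Achievability

/-- At rates zero there is a single word and no error, even if the capacity is zero; this covers
users whose rate cannot lie strictly below capacity. -/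
theorem tendsto_mlBound_messageCount {F : Type*} [Fintype F] (P : stdSimplex ℝ F) {r s : ℝ}
    (hr : 0 ≤ r) (hs : 0 ≤ s) (h : r + s < capacity P ∨ (r = 0 ∧ s = 0)) :
    Tendsto (fun n => mlBound (iid P n) (messageCount r n * messageCount s n)) atTop (𝓝 0) := by
  rcases h with h | ⟨rfl, rfl⟩
  · refine tendsto_mlBound P (c := 4) (ρ := r + s)
      (fun n => Nat.mul_pos (messageCount_pos r n) (messageCount_pos s n)) (fun n => ?_) h
    rw [Nat.cast_mul, mul_add, Real.exp_add]
    refine (mul_le_mul (messageCount_le hr n) (messageCount_le hs n) (by positivity)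
      (by positivity)).trans (le_of_eq (by ring))
  · simp [messageCount_zero, mlBound_one]

theorem tendsto_resolvabilityBound_messageCount {F : Type*} [Fintype F] (P : stdSimplex ℝ F)
    (r s t : ℝ) (h : capacity P < r + (s + t) ∨ capacity P = 0) :
    Tendsto (fun n => resolvabilityBound (iid P n)
      (messageCount r n * (messageCount s n * messageCount t n))) atTop (𝓝 0) := by
  rcases h with h | h
  · refine tendsto_resolvabilityBound_of_lt P (fun n => ?_) h
    rw [mul_add, mul_add, Real.exp_add, Real.exp_add]
    push_cast
    gcongr <;> exact exp_le_messageCount _ _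
  · exact tendsto_resolvabilityBound_of_capacity_eq_zero P h _

instance (r : ℝ) (n : ℕ) : NeZero (messageCount r n) := ⟨(messageCount_pos r n).ne'⟩

variable {F : Type*} [Field F] [Fintype F]

theorem eventually_exists_code (a₁ : F) {b₁ a₂ : F} (b₂ : F) {a₃ b₃ : F} (hb₁ : b₁ ≠ 0)
    (ha₂ : a₂ ≠ 0) (ha₃ : a₃ ≠ 0) (hb₃ : b₃ ≠ 0) (N : stdSimplex ℝ (F × F × F))
    {r₁ s₁ r₂ s₂ : ℝ} (hr₁ : 0 ≤ r₁) (hs₁ : 0 ≤ s₁) (hr₂ : 0 ≤ r₂) (hs₂ : 0 ≤ s₂)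
    (h₁ : r₁ + s₁ < capacity (noise₂ N) ∨ (r₁ = 0 ∧ s₁ = 0))
    (h₂ : r₂ + s₂ < capacity (noise₁ N) ∨ (r₂ = 0 ∧ s₂ = 0))
    (h₃ : capacity (noise₃ N) < r₂ + (s₁ + s₂) ∨ capacity (noise₃ N) = 0)
    (h₄ : capacity (noise₃ N) < r₁ + (s₁ + s₂) ∨ capacity (noise₃ N) = 0)
    {δ : ℝ} (hδ : 0 < δ) :
    ∀ᶠ n in atTop, ∃ C : Code F F F F EncoderType.nonadaptive DecoderType.second n,
      |C.rate₁ - r₁| ≤ δ ∧ |C.rate₂ - r₂| ≤ δ ∧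
      C.errorProb (additiveChannel a₁ b₁ a₂ b₂ a₃ b₃ N) ≤ δ ∧
      C.leakage₁ (additiveChannel a₁ b₁ a₂ b₂ a₃ b₃ N) ≤ δ ∧
      C.leakage₂ (additiveChannel a₁ b₁ a₂ b₂ a₃ b₃ N) ≤ δ := by
  have hB := ((tendsto_mlBound_messageCount (noise₁ N) hr₂ hs₂ h₂).add
    (tendsto_mlBound_messageCount (noise₂ N) hr₁ hs₁ h₁)).add
    (tendsto_resolvabilityBound_messageCount (noise₃ N) r₂ s₁ s₂ h₃) |>.add
    (tendsto_resolvabilityBound_messageCount (noise₃ N) r₁ s₁ s₂ h₄)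
  simp only [add_zero] at hB
  filter_upwards [hB.eventually_le_const hδ,
    (tendsto_log_messageCount_div hr₁).eventually (Metric.closedBall_mem_nhds r₁ hδ),
    (tendsto_log_messageCount_div hr₂).eventually (Metric.closedBall_mem_nhds r₂ hδ)]
    with n hn hn₁ hn₂
  obtain ⟨C, hL₁, hL₂, hC⟩ := exists_code_le a₁ b₂ hb₁ ha₂ ha₃ hb₃ N n _ _ _ _ hn
  refine ⟨C, ?_, ?_, hC⟩
  · rw [Code.rate₁, hL₁, ← Real.dist_eq]
    exact hn₁
  · rw [Code.rate₂, hL₂, ← Real.dist_eq]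
    exact hn₂

theorem exists_rates {C₁ C₂ C₃ : ℝ} (h₁ : C₃ ≤ C₁) (h₂ : C₃ ≤ C₂) (h₃ : 0 ≤ C₃) {R₁ R₂ : ℝ}
    (hR₁ : 0 ≤ R₁) (hR₂ : 0 ≤ R₂) (hC₁ : R₁ ≤ C₁) (hC₂ : R₂ ≤ C₂) {δ : ℝ} (hδ : 0 < δ) :
    ∃ r₁ s₁ r₂ s₂ : ℝ, 0 ≤ r₁ ∧ 0 ≤ s₁ ∧ 0 ≤ r₂ ∧ 0 ≤ s₂ ∧
      (r₁ + s₁ < C₁ ∨ (r₁ = 0 ∧ s₁ = 0)) ∧ (r₂ + s₂ < C₂ ∨ (r₂ = 0 ∧ s₂ = 0)) ∧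
      (C₃ < r₂ + (s₁ + s₂) ∨ C₃ = 0) ∧ (C₃ < r₁ + (s₁ + s₂) ∨ C₃ = 0) ∧
      |r₁ - R₁| ≤ δ ∧ |r₂ - R₂| ≤ δ := by
  rcases h₃.eq_or_lt with h0 | h0
  -- With uniform `N₃` no dither is needed; the rate only has to drop strictly below capacity or be
  -- zero.
  · have key : ∀ {R C : ℝ}, 0 ≤ R → R ≤ C →
        ∃ r, 0 ≤ r ∧ (r + 0 < C ∨ (r = 0 ∧ (0 : ℝ) = 0)) ∧ |r - R| ≤ δ := by
      intro R C hR hC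
      rcases le_total R δ with h | h
      · exact ⟨0, le_rfl, Or.inr ⟨rfl, rfl⟩, by rw [abs_le]; constructor <;> linarith⟩
      · exact ⟨R - δ, by linarith, Or.inl (by linarith), by rw [abs_le]; constructor <;> linarith⟩
    obtain ⟨r₁, hr₁, hr₁', hr₁''⟩ := key hR₁ hC₁
    obtain ⟨r₂, hr₂, hr₂', hr₂''⟩ := key hR₂ hC₂
    exact ⟨r₁, 0, r₂, 0, hr₁, le_rfl, hr₂, le_rfl, hr₁', hr₂', Or.inr h0.symm, Or.inr h0.symm,
      hr₁'', hr₂''⟩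
  -- With `rᵢ ≤ Cᵢ - 3η` and `sᵢ = Cᵢ - rᵢ - η`, one has `sᵢ ≥ 2η` and `rᵢ + sᵢ = Cᵢ - η`. Hence `r₂
  -- + s₂ + s₁ ≥ C₂ + η > C₃`, and likewise with the users exchanged.
  · obtain ⟨η, hη, hηδ, hηC⟩ : ∃ η, 0 < η ∧ 3 * η ≤ δ ∧ 3 * η ≤ C₃ :=
      ⟨min δ C₃ / 3, by positivity, by linarith [min_le_left δ C₃], by linarith [min_le_right δ C₃]⟩
    have key : ∀ {R C : ℝ}, 0 ≤ R → R ≤ C → C₃ ≤ C →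
        ∃ r, 0 ≤ r ∧ r ≤ C - 3 * η ∧ |r - R| ≤ δ := by
      intro R C hR hC hC₃
      rcases le_total R (3 * η) with h | h
      · exact ⟨0, le_rfl, by linarith, by rw [abs_le]; constructor <;> linarith⟩
      · exact ⟨R - 3 * η, by linarith, by linarith, by rw [abs_le]; constructor <;> linarith⟩
    obtain ⟨r₁, hr₁, hr₁', hr₁''⟩ := key hR₁ hC₁ h₁
    obtain ⟨r₂, hr₂, hr₂', hr₂''⟩ := key hR₂ hC₂ h₂
    exact ⟨r₁, C₁ - r₁ - η, r₂, C₂ - r₂ - η, hr₁, by linarith, hr₂, by linarith,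
      Or.inl (by linarith), Or.inl (by linarith), Or.inl (by linarith), Or.inl (by linarith),
      hr₁'', hr₂''⟩

/-- Near-minimizers of a nonnegative cost that can be made small eventually have vanishing cost. -/
theorem exists_tendsto_zero_of_eventually_exists_le {A : ℕ → Type*} [∀ n, Nonempty (A n)]
    (f : ∀ n, A n → ℝ) (hf : ∀ n a, 0 ≤ f n a)
    (h : ∀ δ > 0, ∀ᶠ n in atTop, ∃ a, f n a ≤ δ) :
    ∃ a : ∀ n, A n, Tendsto (fun n => f n (a n)) atTop (𝓝 0) := by
  have hbdd : ∀ n, BddBelow (Set.range (f n)) := fun n => ⟨0, by rintro _ ⟨a, rfl⟩; exact hf n a⟩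
  have hex : ∀ n : ℕ, ∃ a, f n a < (⨅ a, f n a) + 1 / ((n : ℝ) + 1) := fun n =>
    exists_lt_of_ciInf_lt (lt_add_of_pos_right _ (by positivity))
  choose a ha using hex
  refine ⟨a, ?_⟩
  have hinf : Tendsto (fun n => ⨅ a, f n a) atTop (𝓝 0) := by
    rw [Metric.tendsto_nhds]
    intro δ hδ
    filter_upwards [h (δ / 2) (half_pos hδ)] with n hn
    obtain ⟨a', ha'⟩ := hn
    rw [Real.dist_0_eq_abs, abs_of_nonneg (le_ciInf (hf n))]
    exact ((ciInf_le (hbdd n) a').trans ha').trans_lt (half_lt_self hδ)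
  have hlim : Tendsto (fun n : ℕ => (⨅ a, f n a) + 1 / ((n : ℝ) + 1)) atTop (𝓝 0) := by
    simpa using hinf.add tendsto_one_div_add_atTop_nhds_zero_nat
  exact squeeze_zero (fun n => hf n _) (fun n => (ha n).le) hlim

theorem outerRegion_subset_individualCapacityRegion (a₁ : F) {b₁ a₂ : F} (b₂ : F) {a₃ b₃ : F}
    (hb₁ : b₁ ≠ 0) (ha₂ : a₂ ≠ 0) (ha₃ : a₃ ≠ 0) (hb₃ : b₃ ≠ 0)
    (N : stdSimplex ℝ (F × F × F))
    (hN : max (entropy (noise₁ N)) (entropy (noise₂ N)) ≤ entropy (noise₃ N))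
    (b : SecrecyType) (c : EncoderType) (d : DecoderType) :
    outerRegion N ⊆ individualCapacityRegion (additiveChannel a₁ b₁ a₂ b₂ a₃ b₃ N) b c d := by
  classical
  rintro ⟨R₁, R₂⟩ ⟨hR₁, hR₂, hC₁, hC₂⟩
  set W := additiveChannel a₁ b₁ a₂ b₂ a₃ b₃ N with hW
  -- One cost collects the rate gaps, the error and the leakages, so a single sequence of
  -- near-minimizers meets all requirements and its cost serves as both `ε` and `τ`.
  let f : ∀ n, Code F F F F c d n → ℝ := fun n C =>
    max (max |C.rate₁ - R₁| |C.rate₂ - R₂|)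
      (max (C.errorProb W) (max (C.leakage₁ W) (C.leakage₂ W)))
  have hf : ∀ n C, 0 ≤ f n C := fun n C =>
    (abs_nonneg (C.rate₁ - R₁)).trans ((le_max_left _ _).trans (le_max_left _ _))
  have hne : ∀ n, Nonempty (Code F F F F c d n) := fun n => by
    obtain ⟨C, -⟩ := exists_code_le a₁ b₂ hb₁ ha₂ ha₃ hb₃ N n 1 1 1 1 le_rfl
    obtain ⟨C', -⟩ := C.exists_of_nonadaptive_second W c d
    exact ⟨C'⟩
  obtain ⟨C, hC⟩ := exists_tendsto_zero_of_eventually_exists_le f hf (fun δ hδ => by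
    obtain ⟨r₁, s₁, r₂, s₂, hr₁, hs₁, hr₂, hs₂, h₁, h₂, h₃, h₄, hd₁, hd₂⟩ := exists_rates
      (C₁ := capacity (noise₂ N)) (C₂ := capacity (noise₁ N)) (C₃ := capacity (noise₃ N))
      (sub_le_sub_left ((le_max_right _ _).trans hN) _)
      (sub_le_sub_left ((le_max_left _ _).trans hN) _) (divUniform_nonneg _) hR₁ hR₂ hC₁ hC₂
      (half_pos hδ)
    filter_upwards [eventually_exists_code a₁ b₂ hb₁ ha₂ ha₃ hb₃ N hr₁ hs₁ hr₂ hs₂ h₁ h₂ h₃ h₄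
      (half_pos hδ)] with n hn
    obtain ⟨C, c₁, c₂, c₃, c₄, c₅⟩ := hn
    obtain ⟨C', e₁, e₂, e₃, e₄, e₅⟩ := C.exists_of_nonadaptive_second W c d
    refine ⟨C', max_le (max_le ?_ ?_) (max_le ?_ (max_le ?_ ?_))⟩
    · rw [e₁]
      linarith [abs_sub_le C.rate₁ r₁ R₁]
    · rw [e₂]
      linarith [abs_sub_le C.rate₂ r₂ R₂]
    · rw [e₃]; linarith
    · rw [e₄]; linarith
    · rw [e₅]; linarith)
  refine ⟨C, fun n => f n (C n), fun n => f n (C n), hC, hC, ?_, ?_, fun n hn => ⟨?_, ?_, ?_⟩⟩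
  · rw [tendsto_iff_norm_sub_tendsto_zero]
    exact squeeze_zero (fun n => norm_nonneg _)
      (fun n => (le_max_left _ _).trans (le_max_left _ _)) hC
  · rw [tendsto_iff_norm_sub_tendsto_zero]
    exact squeeze_zero (fun n => norm_nonneg _)
      (fun n => (le_max_right _ _).trans (le_max_left _ _)) hC
  · exact (le_max_left _ _).trans (le_max_right _ _)
  all_goals
    have hb : f n (C n) ≤ b.bound (fun n => f n (C n)) n := by
      cases b with
      | strong => exact le_rfl
      | weak => exact le_mul_of_one_le_left (hf n _) (by exact_mod_cast hn)
    refine le_trans ?_ hb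
  · exact (le_max_left _ _).trans ((le_max_right _ _).trans (le_max_right _ _))
  · exact (le_max_right _ _).trans ((le_max_right _ _).trans (le_max_right _ _))

end Achievability

/-! ### Change of measure and the one-shot converse. -/

section Converse

/-- A product of kernels of total mass `c`, whose `t`-th factor depends on the past. -/
theorem sum_prod_kernel_eq_pow {A : Type*} [Fintype A] {n : ℕ} {c : ℝ} (hc : c ≠ 0)
    (K : (t : Fin n) → (Fin t → A) → A → ℝ) (hK : ∀ t p, ∑ a, K t p a = c) :
    ∑ a : Fin n → A, ∏ t : Fin n, K t (past a t) (a t) = c ^ n := by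
  rcases Nat.eq_zero_or_pos n with rfl | h0
  · simp
  -- `sum_prod_kernel` wants kernels at all times; those from time `n` on are dummies that never
  -- enter the product.
  let K' : (t : ℕ) → (Fin t → A) → A → ℝ := fun t p a =>
    if ht : t < n then c⁻¹ * K ⟨t, ht⟩ p a else c⁻¹ * K ⟨0, h0⟩ Fin.elim0 a
  have hK' : ∀ t p, ∑ a, K' t p a = 1 := by
    intro t p
    by_cases ht : t < n
    · simp only [K', ht, dif_pos, ← Finset.mul_sum, hK, inv_mul_cancel₀ hc]
    · simp only [K', ht, dif_neg, not_false_eq_true, ← Finset.mul_sum, hK, inv_mul_cancel₀ hc]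
  have h1 := sum_prod_kernel n K' hK'
  have h2 : ∀ a : Fin n → A, ∏ t : Fin n, K' t (past a t) (a t)
      = (c ^ n)⁻¹ * ∏ t : Fin n, K t (past a t) (a t) := by
    intro a
    simp only [K', Fin.is_lt, dif_pos, Finset.prod_mul_distrib, Finset.prod_const,
      Finset.card_univ, Fintype.card_fin, inv_pow]
  simp_rw [h2, ← Finset.mul_sum] at h1
  exact (inv_mul_eq_one₀ (pow_ne_zero n hc)).1 h1 |>.symm

variable {F : Type*} [Fintype F]

open Classical in
/-- The conditional probability of `N₁ = ν₁`, `N₃ = ν₃` given `N₂ = ν₂`. -/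
def condNoise [Zero F] (N : stdSimplex ℝ (F × F × F)) (ν₁ ν₂ ν₃ : F) : ℝ :=
  if noise₂ N ν₂ = 0 then (if ν₁ = 0 then 1 else 0) * (if ν₃ = 0 then 1 else 0)
  else N (ν₁, ν₂, ν₃) / noise₂ N ν₂

theorem noise₂_apply (N : stdSimplex ℝ (F × F × F)) (ν₂ : F) :
    noise₂ N ν₂ = ∑ ν₁, ∑ ν₃, N (ν₁, ν₂, ν₃) := by
  classical
  rw [noise₂, map_apply_eq_sum, Fintype.sum_prod_type]
  refine Finset.sum_congr rfl fun ν₁ _ => ?_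
  rw [Fintype.sum_prod_type, Finset.sum_eq_single ν₂]
  · simp
  · intro ν _ h
    simp [h]
  · simp

theorem condNoise_nonneg [Zero F] (N : stdSimplex ℝ (F × F × F)) (ν₁ ν₂ ν₃ : F) :
    0 ≤ condNoise N ν₁ ν₂ ν₃ := by
  rw [condNoise]
  split_ifs <;> first | positivity | exact div_nonneg (stdSimplex.zero_le _ _) (stdSimplex.zero_le _ _)

theorem noise₂_mul_condNoise [Zero F] (N : stdSimplex ℝ (F × F × F)) (ν₁ ν₂ ν₃ : F) :
    N (ν₁, ν₂, ν₃) = noise₂ N ν₂ * condNoise N ν₁ ν₂ ν₃ := by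
  by_cases h : noise₂ N ν₂ = 0
  · rw [h, zero_mul]
    refine le_antisymm ?_ (stdSimplex.zero_le _ _)
    rw [← h, noise₂_apply]
    refine (Finset.single_le_sum (f := fun ν₃ => N (ν₁, ν₂, ν₃)) (fun _ _ => stdSimplex.zero_le _ _)
      (Finset.mem_univ ν₃)).trans ?_
    exact Finset.single_le_sum (f := fun ν₁ => ∑ ν₃, N (ν₁, ν₂, ν₃))
      (fun _ _ => Finset.sum_nonneg fun _ _ => stdSimplex.zero_le _ _) (Finset.mem_univ ν₁)
  · rw [condNoise, if_neg h, mul_div_cancel₀ _ h]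

/-- The point mass chosen in `condNoise` at null values of `ν₂` makes this hold everywhere. That is
needed since the change of measure also visits noise values that never occur. -/
theorem sum_condNoise [Zero F] (N : stdSimplex ℝ (F × F × F)) (ν₂ : F) :
    ∑ ν₁, ∑ ν₃, condNoise N ν₁ ν₂ ν₃ = 1 := by
  classical
  by_cases h : noise₂ N ν₂ = 0
  · simp only [condNoise, if_pos h, ← Finset.mul_sum, Finset.sum_ite_eq', Finset.mem_univ, if_true,
      mul_one]
  · simp only [condNoise, if_neg h, ← Finset.sum_div]
    rw [← noise₂_apply, div_self h]

variable [Field F] (a₁ b₁ a₂ b₂ a₃ b₃ : F) (N : stdSimplex ℝ (F × F × F)) {n L₁ L₂ : ℕ}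

/-- A trace is determined by what the second user sees and by the rest. -/
def observedEquiv (F : Type*) (n : ℕ) :
    (Fin n → F × F) × (Fin n → F × F × F) ≃ Trace F F F F F n where
  toFun p t := ((p.2 t).1, (p.1 t).1, (p.2 t).2.1, (p.1 t).2, (p.2 t).2.2)
  invFun a := (fun t => (a.x₂ t, a.y₂ t), fun t => (a.x₁ t, a.y₁ t, a.z t))
  left_inv _ := rfl
  right_inv _ := rfl

/-- The second noise of a trace. -/
def traceNoise₂ (a : Trace F F F F F n) (t : Fin n) : F := a.y₂ t - (a₂ * a.x₁ t + b₂ * a.x₂ t)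

/-- The product of the conditional probabilities of the other noises given the second noise. -/
def condNoiseProd (a : Trace F F F F F n) : ℝ :=
  ∏ t, condNoise N (a.y₁ t - (a₁ * a.x₁ t + b₁ * a.x₂ t)) (traceNoise₂ a₂ b₂ a t)
    (a.z t - (a₃ * a.x₁ t + b₃ * a.x₂ t))

theorem condNoiseProd_nonneg (a : Trace F F F F F n) :
    0 ≤ condNoiseProd a₁ b₁ a₂ b₂ a₃ b₃ N a :=
  Finset.prod_nonneg fun _ _ => condNoise_nonneg _ _ _ _

theorem traceProb_eq_mul_condNoiseProd {c : EncoderType} (e₁ : Encoder F F n L₁ c)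
    (e₂ : Encoder F F n L₂ c) (m₁ : Fin L₁) (m₂ : Fin L₂) (a : Trace F F F F F n) :
    traceProb (additiveChannel a₁ b₁ a₂ b₂ a₃ b₃ N) e₁ e₂ m₁ m₂ a
      = e₁.prob m₁ a.x₁ a.y₁ * e₂.prob m₂ a.x₂ a.y₂ *
        (iid (noise₂ N) n (traceNoise₂ a₂ b₂ a) * condNoiseProd a₁ b₁ a₂ b₂ a₃ b₃ N a) := by
  rw [traceProb, iid_apply, condNoiseProd, ← Finset.prod_mul_distrib]
  congr 1
  refine Finset.prod_congr rfl fun t _ => ?_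
  rw [additiveChannel_apply, noise₂_mul_condNoise]
  rfl

/-- Adaptive inputs depend on past noise, but the current noise is independent of the past and of
both current inputs, so each step contributes the same mean of `h`. -/
theorem sum_traceProb_mul_prod (φ₁ : (t : Fin n) → Fin L₁ → (Fin t → F) → (Fin t → F) → stdSimplex ℝ F)
    (φ₂ : (t : Fin n) → Fin L₂ → (Fin t → F) → (Fin t → F) → stdSimplex ℝ F)
    (m₁ : Fin L₁) (m₂ : Fin L₂) (h : F → ℝ) (hh : ∑ ν, noise₂ N ν * h ν ≠ 0) :
    ∑ a, traceProb (additiveChannel a₁ b₁ a₂ b₂ a₃ b₃ N) (.adaptive φ₁) (.adaptive φ₂) m₁ m₂ a *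
        ∏ t, h (traceNoise₂ a₂ b₂ a t)
      = (∑ ν, noise₂ N ν * h ν) ^ n := by
  let K : (t : Fin n) → (Fin t → F × F × F × F × F) → F × F × F × F × F → ℝ := fun t p b =>
    φ₁ t m₁ (fun s => (p s).1) (fun s => (p s).2.2.1) b.1 *
      (φ₂ t m₂ (fun s => (p s).2.1) (fun s => (p s).2.2.2.1) b.2.1 *
      (additiveChannel a₁ b₁ a₂ b₂ a₃ b₃ N b.1 b.2.1 b.2.2 *
        h (b.2.2.2.1 - (a₂ * b.1 + b₂ * b.2.1))))
  have hK : ∀ t p, ∑ b, K t p b = ∑ ν, noise₂ N ν * h ν := by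
    intro t p
    have h1 : ∀ x₁ x₂ : F, ∑ w : F × F × F, additiveChannel a₁ b₁ a₂ b₂ a₃ b₃ N x₁ x₂ w *
        h (w.2.1 - (a₂ * x₁ + b₂ * x₂)) = ∑ ν, noise₂ N ν * h ν := by
      intro x₁ x₂
      rw [additiveChannel, noise₂, sum_map_mul, sum_map_mul]
      simp
    simp only [K]
    rw [Fintype.sum_prod_type]
    simp_rw [Fintype.sum_prod_type (f := fun b : F × F × F × F => _), ← Finset.mul_sum, h1,
      ← Finset.sum_mul, stdSimplex.sum_eq_one, one_mul]
  rw [← sum_prod_kernel_eq_pow hh K hK]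
  refine Finset.sum_congr rfl fun a _ => ?_
  simp only [traceProb, Encoder.prob, ← Finset.prod_mul_distrib]
  refine Finset.prod_congr rfl fun t _ => ?_
  simp only [K, mul_assoc]
  rfl

/-- With the observation `o` of User 2 frozen and the factor of `N₂` removed, the rest is a causal
process in `(x₁, y₁, z)` of mass 1. The result does not involve `m₁`: under the changed measure User
2 learns nothing about it. -/
theorem sum_prob_mul_condNoiseProd
    (φ₁ : (t : Fin n) → Fin L₁ → (Fin t → F) → (Fin t → F) → stdSimplex ℝ F) (m₁ : Fin L₁)
    (o : Fin n → F × F) :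
    ∑ s, (Encoder.adaptive φ₁).prob m₁ (observedEquiv F n (o, s)).x₁ (observedEquiv F n (o, s)).y₁ *
      condNoiseProd a₁ b₁ a₂ b₂ a₃ b₃ N (observedEquiv F n (o, s)) = 1 := by
  let K : (t : Fin n) → (Fin t → F × F × F) → F × F × F → ℝ := fun t p b =>
    φ₁ t m₁ (fun s => (p s).1) (fun s => (p s).2.1) b.1 *
      condNoise N (b.2.1 - (a₁ * b.1 + b₁ * (o t).1)) ((o t).2 - (a₂ * b.1 + b₂ * (o t).1))
        (b.2.2 - (a₃ * b.1 + b₃ * (o t).1))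
  have hK : ∀ t p, ∑ b, K t p b = 1 := by
    intro t p
    have h1 : ∀ c₁ ν c₃ : F, ∑ w : F × F, condNoise N (w.1 - c₁) ν (w.2 - c₃) = 1 := by
      intro c₁ ν c₃
      rw [Fintype.sum_prod_type, ← sum_condNoise N ν]
      refine Eq.trans ?_ (Equiv.sum_comp (Equiv.subRight c₁) fun ν₁ => ∑ ν₃, condNoise N ν₁ ν ν₃)
      exact Finset.sum_congr rfl fun y _ =>
        Equiv.sum_comp (Equiv.subRight c₃) fun ν₃ => condNoise N (y - c₁) ν ν₃
    simp only [K]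
    rw [Fintype.sum_prod_type]
    simp_rw [← Finset.mul_sum, h1, mul_one, stdSimplex.sum_eq_one]
  have h := sum_prod_kernel_eq_pow one_ne_zero K hK
  rw [one_pow] at h
  rw [← h]
  refine Finset.sum_congr rfl fun s _ => ?_
  simp only [Encoder.prob, condNoiseProd, ← Finset.prod_mul_distrib]
  rfl

theorem sum_prob_eq_card_pow
    (φ₂ : (t : Fin n) → Fin L₂ → (Fin t → F) → (Fin t → F) → stdSimplex ℝ F) (m₂ : Fin L₂) :
    ∑ o : Fin n → F × F, (Encoder.adaptive φ₂).prob m₂ (fun t => (o t).1) (fun t => (o t).2)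
      = (Fintype.card F : ℝ) ^ n := by
  have hc : (Fintype.card F : ℝ) ≠ 0 := by exact_mod_cast Fintype.card_ne_zero
  refine sum_prod_kernel_eq_pow hc (fun t (p : Fin t → F × F) (b : F × F) =>
    φ₂ t m₂ (fun s => (p s).1) (fun s => (p s).2) b.1) fun t p => ?_
  rw [Fintype.sum_prod_type_right]
  simp

/-- Either the likelihood ratio `q ^ n P` of the noise is at least `exp (n γ)`, and the exponential
factor exceeds 1, or `P` is at most `exp (n γ)` times the uniform probability. -/
theorem traceProb_le {c : EncoderType} (e₁ : Encoder F F n L₁ c)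
    (e₂ : Encoder F F n L₂ c) (m₁ : Fin L₁) (m₂ : Fin L₂) {σ : ℝ} (hσ : 0 < σ) (γ : ℝ)
    (a : Trace F F F F F n) :
    traceProb (additiveChannel a₁ b₁ a₂ b₂ a₃ b₃ N) e₁ e₂ m₁ m₂ a
      ≤ traceProb (additiveChannel a₁ b₁ a₂ b₂ a₃ b₃ N) e₁ e₂ m₁ m₂ a *
          ∏ t, Real.exp (σ * (Real.log (Fintype.card F * noise₂ N (traceNoise₂ a₂ b₂ a t)) - γ))
        + Real.exp (n * γ) / (Fintype.card F : ℝ) ^ n * (e₁.prob m₁ a.x₁ a.y₁ *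
          e₂.prob m₂ a.x₂ a.y₂ * condNoiseProd a₁ b₁ a₂ b₂ a₃ b₃ N a) := by
  have hc : 0 < (Fintype.card F : ℝ) := by exact_mod_cast Fintype.card_pos
  rw [traceProb_eq_mul_condNoiseProd]
  have hE : 0 ≤ e₁.prob m₁ a.x₁ a.y₁ * e₂.prob m₂ a.x₂ a.y₂ :=
    mul_nonneg (e₁.prob_nonneg _ _ _) (e₂.prob_nonneg _ _ _)
  have hV := condNoiseProd_nonneg a₁ b₁ a₂ b₂ a₃ b₃ N a
  have hP : 0 ≤ iid (noise₂ N) n (traceNoise₂ a₂ b₂ a) := stdSimplex.zero_le _ _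
  rcases iid_eq_zero_or_pos (noise₂ N) (traceNoise₂ a₂ b₂ a) with h0 | hpos
  · rw [h0]
    simp only [zero_mul, mul_zero, zero_add]
    positivity
  rw [prod_exp_mul_log_sub hpos]
  set E := e₁.prob m₁ a.x₁ a.y₁ * e₂.prob m₂ a.x₂ a.y₂
  set V := condNoiseProd a₁ b₁ a₂ b₂ a₃ b₃ N a
  set P := iid (noise₂ N) n (traceNoise₂ a₂ b₂ a)
  have hcard : (Fintype.card (Fin n → F) : ℝ) = (Fintype.card F : ℝ) ^ n := by simp
  rw [hcard]
  rcases le_total 1 ((Fintype.card F : ℝ) ^ n * P / Real.exp (n * γ)) with h | h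
  · have h1 := Real.one_le_rpow h hσ.le
    have h2 : E * (P * V) ≤ E * (P * V) * ((Fintype.card F : ℝ) ^ n * P / Real.exp (n * γ)) ^ σ :=
      le_mul_of_one_le_right (by positivity) h1
    have h3 : 0 ≤ Real.exp (n * γ) / (Fintype.card F : ℝ) ^ n * (E * V) := by positivity
    linarith
  · have h1 : P ≤ Real.exp (n * γ) / (Fintype.card F : ℝ) ^ n := by
      rw [div_le_one (Real.exp_pos _)] at h
      rw [le_div_iff₀ (by positivity)]
      linarith
    have h2 := mul_le_mul_of_nonneg_right h1 (mul_nonneg hE hV)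
    have h3 : 0 ≤ E * (P * V) * ((Fintype.card F : ℝ) ^ n * P / Real.exp (n * γ)) ^ σ := by
      positivity
    linarith

open Classical in
-- Under the changed weight `Q`, the decoder outputs exactly one `m₁` per observation, so summing
-- over `m₁` leaves the total mass `q ^ n`, not `L₁ q ^ n`. This is the source of `1 / L₁`.
theorem sum_traceProb_decode_le {c : EncoderType} (e₁ : Encoder F F n L₁ c)
    (e₂ : Encoder F F n L₂ c) (hL₁ : 0 < L₁) (hL₂ : 0 < L₂)
    (ψ : Fin L₂ → (Fin n → F) → (Fin n → F) → Fin L₁) {σ : ℝ} (hσ : 0 < σ) (γ : ℝ) :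
    ((L₁ : ℝ) * L₂)⁻¹ * ∑ m₁, ∑ m₂, ∑ a,
        traceProb (additiveChannel a₁ b₁ a₂ b₂ a₃ b₃ N) e₁ e₂ m₁ m₂ a *
          (if ψ m₂ a.x₂ a.y₂ = m₁ then 1 else 0)
      ≤ (∑ ν, noise₂ N ν * Real.exp (σ * (Real.log (Fintype.card F * noise₂ N ν) - γ))) ^ n
        + Real.exp (n * γ) / L₁ := by
  have hq : 0 < (Fintype.card F : ℝ) := by exact_mod_cast Fintype.card_pos
  have hl₁ : (0 : ℝ) < L₁ := by exact_mod_cast hL₁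
  have hl₂ : (0 : ℝ) < L₂ := by exact_mod_cast hL₂
  obtain ⟨e₁', he₁⟩ := e₁.exists_adaptive
  obtain ⟨e₂', he₂⟩ := e₂.exists_adaptive
  have hT : ∀ m₁ m₂ a, traceProb (additiveChannel a₁ b₁ a₂ b₂ a₃ b₃ N) e₁ e₂ m₁ m₂ a
      = traceProb (additiveChannel a₁ b₁ a₂ b₂ a₃ b₃ N) e₁' e₂' m₁ m₂ a := by
    intro m₁ m₂ a
    simp only [traceProb, he₁, he₂]
  simp_rw [hT]
  cases e₁' with
  | adaptive φ₁ =>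
  cases e₂' with
  | adaptive φ₂ =>
  set g := ∑ ν, noise₂ N ν * Real.exp (σ * (Real.log (Fintype.card F * noise₂ N ν) - γ)) with hg
  have hg0 : g ≠ 0 := by
    have h1 : 0 ≤ g := Finset.sum_nonneg fun _ _ =>
      mul_nonneg (stdSimplex.zero_le _ _) (Real.exp_pos _).le
    intro h
    have h2 := (Finset.sum_eq_zero_iff_of_nonneg fun ν _ =>
      mul_nonneg (stdSimplex.zero_le (noise₂ N) ν) (Real.exp_pos _).le).1 h
    have h3 : ∀ ν, noise₂ N ν = 0 := fun ν =>
      (mul_eq_zero.1 (h2 ν (Finset.mem_univ ν))).resolve_right (Real.exp_pos _).ne'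
    have h4 := stdSimplex.sum_eq_one (noise₂ N)
    simp [h3] at h4
  let ind : Fin L₁ → Fin L₂ → Trace F F F F F n → ℝ := fun m₁ m₂ a =>
    if ψ m₂ a.x₂ a.y₂ = m₁ then 1 else 0
  let Q : Fin L₁ → Fin L₂ → Trace F F F F F n → ℝ := fun m₁ m₂ a =>
    (Encoder.adaptive φ₁).prob m₁ a.x₁ a.y₁ * (Encoder.adaptive φ₂).prob m₂ a.x₂ a.y₂ *
      condNoiseProd a₁ b₁ a₂ b₂ a₃ b₃ N a
  have h1 : ∀ m₁ m₂, ∑ a, traceProb (additiveChannel a₁ b₁ a₂ b₂ a₃ b₃ N) (.adaptive φ₁)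
      (.adaptive φ₂) m₁ m₂ a * ind m₁ m₂ a
      ≤ g ^ n + Real.exp (n * γ) / (Fintype.card F : ℝ) ^ n * ∑ a, Q m₁ m₂ a * ind m₁ m₂ a := by
    intro m₁ m₂
    rw [hg, ← sum_traceProb_mul_prod a₁ b₁ a₂ b₂ a₃ b₃ N φ₁ φ₂ m₁ m₂ _ hg0, Finset.mul_sum,
      ← Finset.sum_add_distrib]
    refine Finset.sum_le_sum fun a _ => ?_
    have h2 := traceProb_le a₁ b₁ a₂ b₂ a₃ b₃ N (.adaptive φ₁) (.adaptive φ₂) m₁ m₂ hσ γ a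
    have hT0 : 0 ≤ traceProb (additiveChannel a₁ b₁ a₂ b₂ a₃ b₃ N) (.adaptive φ₁)
      (.adaptive φ₂) m₁ m₂ a := (traceProb_mem _ _ _ _ _).1 a
    by_cases h : ψ m₂ a.x₂ a.y₂ = m₁
    · simpa only [ind, Q, if_pos h, mul_one] using h2
    · simp only [ind, if_neg h, mul_zero, add_zero]
      exact mul_nonneg hT0 (Finset.prod_nonneg fun _ _ => (Real.exp_pos _).le)
  have hQ : ∀ m₁ m₂, ∑ a, Q m₁ m₂ a * ind m₁ m₂ a = ∑ o : Fin n → F × F,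
      (Encoder.adaptive φ₂).prob m₂ (fun t => (o t).1) (fun t => (o t).2) *
        (if ψ m₂ (fun t => (o t).1) (fun t => (o t).2) = m₁ then 1 else 0) := by
    intro m₁ m₂
    rw [← (observedEquiv F n).sum_comp, Fintype.sum_prod_type]
    refine Finset.sum_congr rfl fun o _ => ?_
    refine Eq.trans ?_ ((congrArg (_ * ·)
      (sum_prob_mul_condNoiseProd a₁ b₁ a₂ b₂ a₃ b₃ N φ₁ m₁ o)).trans (mul_one _))
    rw [Finset.mul_sum]
    refine Finset.sum_congr rfl fun s _ => ?_
    have h2 : (observedEquiv F n (o, s)).x₂ = fun t => (o t).1 := rfl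
    have h3 : (observedEquiv F n (o, s)).y₂ = fun t => (o t).2 := rfl
    simp only [Q, ind, h2, h3]
    ring
  have hQsum : ∀ m₂, ∑ m₁, ∑ a, Q m₁ m₂ a * ind m₁ m₂ a = (Fintype.card F : ℝ) ^ n := by
    intro m₂
    simp_rw [hQ]
    rw [Finset.sum_comm, ← sum_prob_eq_card_pow φ₂ m₂]
    exact Finset.sum_congr rfl fun o _ => by simp
  have h2 := Finset.sum_le_sum fun m₁ (_ : m₁ ∈ Finset.univ) =>
    Finset.sum_le_sum fun m₂ (_ : m₂ ∈ Finset.univ) => h1 m₁ m₂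
  simp_rw [Finset.sum_add_distrib, ← Finset.mul_sum] at h2
  rw [Finset.sum_comm (f := fun m₁ m₂ => ∑ a, Q m₁ m₂ a * ind m₁ m₂ a)] at h2
  simp_rw [hQsum] at h2
  simp only [Finset.sum_const, Finset.card_univ, Fintype.card_fin, nsmul_eq_mul] at h2
  refine (mul_le_mul_of_nonneg_left h2 (by positivity)).trans (le_of_eq ?_)
  field_simp

end Converse

/-! ### Exchange of users and the asymptotic form of the converse. -/

section ErrorProb

variable {F : Type*} [Fintype F] (N : stdSimplex ℝ (F × F × F)) {c : EncoderType} {d : DecoderType}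
  {n : ℕ}

/-- The noise law with the two users exchanged. -/
def swapNoise (N : stdSimplex ℝ (F × F × F)) : stdSimplex ℝ (F × F × F) :=
  stdSimplex.map (fun ν => (ν.2.1, ν.1, ν.2.2)) N

theorem swapNoise_apply (ν₁ ν₂ ν₃ : F) : swapNoise N (ν₂, ν₁, ν₃) = N (ν₁, ν₂, ν₃) := by
  classical
  rw [swapNoise, map_apply_eq_sum, Finset.sum_eq_single (ν₁, ν₂, ν₃)]
  · simp
  · rintro ⟨ν₁', ν₂', ν₃'⟩ _ h
    rw [if_neg, mul_zero]
    intro h'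
    simp only [Prod.mk.injEq] at h'
    obtain ⟨rfl, rfl, rfl⟩ := h'
    exact h rfl
  · simp

theorem noise₂_swapNoise : noise₂ (swapNoise N) = noise₁ N := by
  rw [noise₂, swapNoise, stdSimplex.map_comp_apply]
  rfl

open Classical in
theorem one_sub_errorProb_le (C : Code F F F F c d n) (W : Channel F F F F F)
    (A : Fin C.L₁ → Fin C.L₂ → Trace F F F F F n → Prop)
    (hA : ∀ m₁ m₂ a, ¬ A m₁ m₂ a →
      C.dec₂.decode m₂ a.x₂ a.y₂ ≠ m₁ ∨ C.dec₁.decode m₁ a.x₁ a.y₁ ≠ m₂) :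
    1 - C.errorProb W ≤ ((C.L₁ : ℝ) * C.L₂)⁻¹ * ∑ m₁, ∑ m₂, ∑ a,
      traceProb W C.enc₁ C.enc₂ m₁ m₂ a * (if A m₁ m₂ a then 1 else 0) := by
  have h1 : (0 : ℝ) < C.L₁ := by exact_mod_cast C.L₁_pos
  have h2 : (0 : ℝ) < C.L₂ := by exact_mod_cast C.L₂_pos
  rw [sub_le_iff_le_add, Code.errorProb, ← mul_add, ← Finset.sum_add_distrib]
  simp_rw [← Finset.sum_add_distrib, Finset.sum_filter]
  have h3 : ∀ m₁ m₂, 1 ≤ ∑ a, traceProb W C.enc₁ C.enc₂ m₁ m₂ a * (if A m₁ m₂ a then 1 else 0) +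
      ∑ a, (if C.dec₂.decode m₂ a.x₂ a.y₂ ≠ m₁ ∨ C.dec₁.decode m₁ a.x₁ a.y₁ ≠ m₂ then
        traceLaw W C.enc₁ C.enc₂ m₁ m₂ a else 0) := by
    intro m₁ m₂
    rw [← Finset.sum_add_distrib]
    refine (traceProb_mem W C.enc₁ C.enc₂ m₁ m₂).2.ge.trans ?_
    refine Finset.sum_le_sum fun a _ => ?_
    have h0 : 0 ≤ traceProb W C.enc₁ C.enc₂ m₁ m₂ a := (traceProb_mem W C.enc₁ C.enc₂ m₁ m₂).1 a
    have h4 : traceLaw W C.enc₁ C.enc₂ m₁ m₂ a = traceProb W C.enc₁ C.enc₂ m₁ m₂ a := rfl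
    rw [h4]
    by_cases h : A m₁ m₂ a
    · rw [if_pos h, mul_one]
      refine le_add_of_nonneg_right ?_
      split_ifs
      · exact h0
      · exact le_rfl
    · rw [if_neg h, mul_zero, zero_add, if_pos (hA _ _ _ h)]
  refine le_trans (le_of_eq ?_) (mul_le_mul_of_nonneg_left (Finset.sum_le_sum fun m₁ _ =>
    Finset.sum_le_sum fun m₂ _ => h3 m₁ m₂) (by positivity))
  simp only [Finset.sum_const, Finset.card_univ, Fintype.card_fin, nsmul_eq_mul, mul_one]
  field_simp

/-- A one-shot bound on the probability of correct decoding, for all thresholds `γ`, bounds the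
rate of codes with a vanishing error probability by the capacity. -/
theorem le_capacity_of_tendsto {P : stdSimplex ℝ F} {L : ℕ → ℕ} (hL : ∀ n, 0 < L n)
    {ε : ℕ → ℝ} (hε : Tendsto ε atTop (𝓝 0)) {R : ℝ}
    (hR : Tendsto (fun n => Real.log (L n) / n) atTop (𝓝 R))
    (h : ∀ n, 1 ≤ n → ∀ σ > 0, ∀ γ : ℝ, 1 - ε n ≤
      (∑ ν, P ν * Real.exp (σ * (Real.log (Fintype.card F * P ν) - γ))) ^ n
        + Real.exp (n * γ) / L n) :
    R ≤ capacity P := by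
  by_contra! hlt
  -- Thresholds with capacity `< γ < ρ < R`: the first gap makes `g < 1`, the second makes `exp (n
  -- γ) / L n` decay, since eventually `L n > exp (n ρ)`.
  obtain ⟨γ, hγ, hγR⟩ := exists_between hlt
  obtain ⟨ρ, hργ, hρR⟩ := exists_between hγR
  have hneg : ∑ ν, P ν * (Real.log (Fintype.card F * P ν) - γ) < 0 := by
    rw [sum_mul_log_sub]
    linarith
  obtain ⟨σ, hσ, -, hg⟩ := exists_sum_mul_exp_lt_one P _ hneg
  set g := ∑ ν, P ν * Real.exp (σ * (Real.log (Fintype.card F * P ν) - γ)) with hgdef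
  have hg0 : 0 ≤ g := Finset.sum_nonneg fun _ _ =>
    mul_nonneg (stdSimplex.zero_le _ _) (Real.exp_pos _).le
  have h1 : Tendsto (fun n : ℕ => Real.exp (γ - ρ) ^ n) atTop (𝓝 0) :=
    tendsto_pow_atTop_nhds_zero_of_lt_one (Real.exp_pos _).le (Real.exp_lt_one_iff.2 (by linarith))
  have h2 : Tendsto (fun n : ℕ => g ^ n + Real.exp (γ - ρ) ^ n + ε n) atTop (𝓝 0) := by
    simpa using ((tendsto_pow_atTop_nhds_zero_of_lt_one hg0 hg).add h1).add hε
  obtain ⟨n, hn, hρn, hn1⟩ := ((h2.eventually_lt_const one_pos).and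
    ((hR.eventually_const_lt hρR).and (eventually_ge_atTop 1))).exists
  have hn0 : (0 : ℝ) < n := by exact_mod_cast hn1
  have hLn : (0 : ℝ) < L n := by exact_mod_cast hL n
  rw [lt_div_iff₀ hn0, Real.lt_log_iff_exp_lt hLn] at hρn
  have h3 : Real.exp (n * γ) / L n ≤ Real.exp (γ - ρ) ^ n := by
    rw [div_le_iff₀ hLn, ← Real.exp_nat_mul, mul_sub, Real.exp_sub, div_mul_eq_mul_div,
      le_div_iff₀ (Real.exp_pos _), mul_comm (n : ℝ) ρ]
    exact mul_le_mul_of_nonneg_left hρn.le (Real.exp_pos _).le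
  have h4 := h n hn1 σ hσ γ
  linarith

end ErrorProb

/-! ### The converse for both users. -/

section OuterBound

variable {F : Type*} [Field F] [Fintype F] (a₁ b₁ a₂ b₂ a₃ b₃ : F) (N : stdSimplex ℝ (F × F × F))
  {c : EncoderType} {d : DecoderType} {n : ℕ}

/-- Exchange of the two users in a trace. -/
def swapTrace (F : Type*) (n : ℕ) : Trace F F F F F n ≃ Trace F F F F F n where
  toFun a t := ((a t).2.1, (a t).1, (a t).2.2.2.1, (a t).2.2.1, (a t).2.2.2.2)
  invFun a t := ((a t).2.1, (a t).1, (a t).2.2.2.1, (a t).2.2.1, (a t).2.2.2.2)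
  left_inv _ := rfl
  right_inv _ := rfl

/-- The model is symmetric under exchanging the users along with their coefficients and noises, so
the bound on the rate of User 1 also yields that of User 2. -/
theorem traceProb_swapTrace {L₁ L₂ : ℕ} (e₁ : Encoder F F n L₁ c)
    (e₂ : Encoder F F n L₂ c) (m₁ : Fin L₁) (m₂ : Fin L₂) (a : Trace F F F F F n) :
    traceProb (additiveChannel b₂ a₂ b₁ a₁ b₃ a₃ (swapNoise N)) e₂ e₁ m₂ m₁ (swapTrace F n a)
      = traceProb (additiveChannel a₁ b₁ a₂ b₂ a₃ b₃ N) e₁ e₂ m₁ m₂ a := by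
  rw [traceProb, traceProb, mul_comm (e₁.prob _ _ _)]
  congr 1
  refine Finset.prod_congr rfl fun t _ => ?_
  rw [additiveChannel_apply, additiveChannel_apply, swapNoise_apply, add_comm (b₁ * _),
    add_comm (b₂ * _), add_comm (b₃ * _)]
  rfl

theorem one_sub_errorProb_le₁ (C : Code F F F F c d n) {σ : ℝ} (hσ : 0 < σ) (γ : ℝ) :
    1 - C.errorProb (additiveChannel a₁ b₁ a₂ b₂ a₃ b₃ N) ≤
      (∑ ν, noise₂ N ν * Real.exp (σ * (Real.log (Fintype.card F * noise₂ N ν) - γ))) ^ n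
        + Real.exp (n * γ) / C.L₁ := by
  classical
  refine (one_sub_errorProb_le C _ (fun m₁ m₂ a => C.dec₂.decode m₂ a.x₂ a.y₂ = m₁)
    fun m₁ m₂ a h => Or.inl h).trans ?_
  refine le_trans (le_of_eq ?_) (sum_traceProb_decode_le a₁ b₁ a₂ b₂ a₃ b₃ N C.enc₁ C.enc₂
    C.L₁_pos C.L₂_pos C.dec₂.decode hσ γ)
  congr 1
  refine Finset.sum_congr rfl fun m₁ _ => Finset.sum_congr rfl fun m₂ _ =>
    Finset.sum_congr rfl fun a _ => ?_
  congr 1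
  split_ifs <;> rfl

theorem one_sub_errorProb_le₂ (C : Code F F F F c d n) {σ : ℝ} (hσ : 0 < σ) (γ : ℝ) :
    1 - C.errorProb (additiveChannel a₁ b₁ a₂ b₂ a₃ b₃ N) ≤
      (∑ ν, noise₁ N ν * Real.exp (σ * (Real.log (Fintype.card F * noise₁ N ν) - γ))) ^ n
        + Real.exp (n * γ) / C.L₂ := by
  classical
  refine (one_sub_errorProb_le C _ (fun m₁ m₂ a => C.dec₁.decode m₁ a.x₁ a.y₁ = m₂)
    fun m₁ m₂ a h => Or.inr h).trans ?_
  have h := sum_traceProb_decode_le b₂ a₂ b₁ a₁ b₃ a₃ (swapNoise N) C.enc₂ C.enc₁ C.L₂_pos C.L₁_pos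
    C.dec₁.decode hσ γ
  rw [noise₂_swapNoise] at h
  refine le_trans (le_of_eq ?_) h
  rw [mul_comm (C.L₁ : ℝ), Finset.sum_comm]
  congr 1
  refine Finset.sum_congr rfl fun m₂ _ => Finset.sum_congr rfl fun m₁ _ => ?_
  refine Eq.trans ?_ ((swapTrace F n).sum_comp _)
  refine Finset.sum_congr rfl fun a _ => ?_
  rw [traceProb_swapTrace, show (swapTrace F n a).x₂ = a.x₁ from rfl,
    show (swapTrace F n a).y₂ = a.y₁ from rfl]
  congr 1
  split_ifs <;> rfl

theorem individualCapacityRegion_subset_outerRegion (b : SecrecyType) (c : EncoderType)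
    (d : DecoderType) :
    individualCapacityRegion (additiveChannel a₁ b₁ a₂ b₂ a₃ b₃ N) b c d ⊆ outerRegion N := by
  rintro ⟨R₁, R₂⟩ ⟨C, ε, τ, hε, -, hR₁, hR₂, h⟩
  refine ⟨ge_of_tendsto' hR₁ fun n => ?_, ge_of_tendsto' hR₂ fun n => ?_,
    le_capacity_of_tendsto (fun n => (C n).L₁_pos) hε hR₁ fun n hn σ hσ γ => ?_,
    le_capacity_of_tendsto (fun n => (C n).L₂_pos) hε hR₂ fun n hn σ hσ γ => ?_⟩
  · exact div_nonneg (Real.log_natCast_nonneg _) (Nat.cast_nonneg _)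
  · exact div_nonneg (Real.log_natCast_nonneg _) (Nat.cast_nonneg _)
  · exact (sub_le_sub_left (h n hn).1 1).trans
      (one_sub_errorProb_le₁ a₁ b₁ a₂ b₂ a₃ b₃ N (C n) hσ γ)
  · exact (sub_le_sub_left (h n hn).1 1).trans
      (one_sub_errorProb_le₂ a₁ b₁ a₂ b₂ a₃ b₃ N (C n) hσ γ)

end OuterBound

end

end TwoWayWiretap

theorem corollary3 {F : Type*} [Field F] [Fintype F]
    (a₁ b₁ a₂ b₂ a₃ b₃ : F)
    (ha₁ : a₁ ≠ 0) (hb₁ : b₁ ≠ 0) (ha₂ : a₂ ≠ 0) (hb₂ : b₂ ≠ 0) (ha₃ : a₃ ≠ 0) (hb₃ : b₃ ≠ 0)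
    (N : stdSimplex ℝ (F × F × F))
    (hN : max (TwoWayWiretap.entropy (TwoWayWiretap.noise₁ N))
        (TwoWayWiretap.entropy (TwoWayWiretap.noise₂ N))
      ≤ TwoWayWiretap.entropy (TwoWayWiretap.noise₃ N))
    (b : TwoWayWiretap.SecrecyType) (c : TwoWayWiretap.EncoderType)
    (d : TwoWayWiretap.DecoderType) :
    TwoWayWiretap.individualCapacityRegion
        (TwoWayWiretap.additiveChannel a₁ b₁ a₂ b₂ a₃ b₃ N) b c d
      = TwoWayWiretap.outerRegion N :=
  Set.Subset.antisymm
    (TwoWayWiretap.individualCapacityRegion_subset_outerRegion a₁ b₁ a₂ b₂ a₃ b₃ N b c d)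
    (TwoWayWiretap.outerRegion_subset_individualCapacityRegion a₁ b₂ hb₁ ha₂ ha₃ hb₃ N hN b c d)
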